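/- **Paths.** Consider càdlàg paths $X:[0,1]\to\mathbb R$ with $X_0\ge 0$ and no negative jump, extended to $[-1,1]$ by $X_t=0$ for $t\in[-1,0)$ (so $X_{0-}=0$ and $\Delta X_0=X_0$). For $s,t\in[0,1]$ write $s\prec t$ if $s<t$ and $X_{s-}\le\inf_{[s,t]}X$, and $s\preceq t$ if $s\prec t$ or $s=t$. Let $R^t_s=\inf_{[s,t]}X-X_{s-}$ if $s\prec t$ and $R^t_s=0$ otherwise, and let $s\wedge t=\sup\{r\in[0,1]: r\preceq s,\ r\preceq t\}$ (with $\sup\emptyset=0$). For $t\in[0,1]$ let $$\overline X{}^t_t=\sup_{r\in[0,t]}\big(X_{t-}-X_{(t-r)-}\big),\qquad J_t=\sum_{r\in[0,1],\,r\prec t}R^t_r,\qquad C_t=\overline X{}^t_t-J_t ,$$ so that $C_t$ is the continuous part, at its terminal time, of the running supremum of the dual path $s\mapsto X_{t-}-X_{(t-s)-}$, $s\in[0,t]$. The path $X$ satisfies the pure jump property (PJ) if $C_t=0$ for every $t\in[0,1]$. **Looptrees.** Let $\delta_r(a,b)=\min\{|a-b|,\Delta X_r-|a-b|\}$ be the metric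 of the cycle of length $\Delta X_r$, and for $s,t\in[0,1]$ set $$d_{\mathrm{Loop}(X)}(s,t)=\delta_{s\wedge t}\big(R^s_{s\wedge t},R^t_{s\wedge t}\big)+\sum_{s\wedge t<r\prec s}\delta_r(0,R^s_r)+\sum_{s\wedge t<r\prec t}\delta_r(0,R^t_r)+\Big(C_s+C_t-2\inf_{[s\wedge_{\mathbb R}t,\,s\vee_{\mathbb R}t]}C\Big),$$ where $\wedge_{\mathbb R},\vee_{\mathbb R}$ are the minimum and maximum of real numbers. $\mathrm{Loop}(X)$ is the quotient of $[0,1]$ by $\{d_{\mathrm{Loop}(X)}=0\}$, with the induced metric and the push-forward of the Lebesgue measure on $[0,1]$. **Gromov–Hausdorff–Prokhorov distance.** For compact metric spaces with Borel probability measures $(E,p)$ and $(E',p')$ it is the infimum of the $\varepsilon>0$ for which there exist a coupling $\nu$ of $p$ and $p'$ and a compact correspondence $\mathcal R\subset E\times E'$ (each point of $E$ and of $E'$ is in relation with at least one point of the other space) with $\nu(\mathcal R)\ge 1-\varepsilon$ and $|d_E(x,x')-d_{E'}(y,y')|\le 2\varepsilon$ for all $(x,y),(x',y')\in\mathcal R$.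 **Proposition.** Let $X$ and $X^n$, $n\geq 1$, be such paths. Suppose that $X^n\to X$ for the Skorokhod ($J_1$) topology on $[-1,1]$ and that $X$ satisfies (PJ). Then $d_{\mathrm{Loop}(X^n)}$ and $d_{\mathrm{Loop}(X)}$ are continuous pseudo-distances on $[0,1]$, so that $\mathrm{Loop}(X^n)$ and $\mathrm{Loop}(X)$ are compact metric spaces with Borel probability measures; moreover $d_{\mathrm{Loop}(X^n)}\to d_{\mathrm{Loop}(X)}$ uniformly on $[0,1]^2$, and $$\mathrm{Loop}(X^n)\longrightarrow\mathrm{Loop}(X)$$ for the Gromov–Hausdorff–Prokhorov distance. (The $X^n$ are not assumed to satisfy (PJ).) -/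

import Mathlib

open Set Filter Topology MeasureTheory
open scoped ENNReal

noncomputable section

namespace Looptree

/-! ### Paths and the Skorokhod topology -/

/-- The paths under consideration: càdlàg on `[0,1]`, with nonnegative value at `0`, without
negative jump, and extended to `[-1,1]` by the value `0` on `[-1,0)`. Thus the left limit at `0`
is `0` and the jump at `0` is `X 0`. The values of `X` outside `[-1,1]` play no role. -/
structure IsPath (X : ℝ → ℝ) : Prop where
  right_cont : ∀ t ∈ Ico (0 : ℝ) 1, ContinuousWithinAt X (Ici t) t
  left_lim : ∀ t ∈ Ioc (0 : ℝ) 1, ∃ l : ℝ, Tendsto X (𝓝[<] t) (𝓝 l)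
  zero_before : ∀ t ∈ Ico (-1 : ℝ) 0, X t = 0
  zero_le : 0 ≤ X 0
  no_neg_jump : ∀ t ∈ Icc (0 : ℝ) 1, Function.leftLim X t ≤ X t

/-- Skorokhod's (J1) distance on `[-1,1]`: the infimum over the increasing bijections `e` of
`[-1,1]` of `max (sup |e t - t|) (sup |X (e t) - Y t|)`. -/
def skorokhodDist (X Y : ℝ → ℝ) : ℝ≥0∞ :=
  ⨅ e : Icc (-1 : ℝ) 1 ≃o Icc (-1 : ℝ) 1,
    max (⨆ t : Icc (-1 : ℝ) 1, ENNReal.ofReal |(e t : ℝ) - (t : ℝ)|)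
      (⨆ t : Icc (-1 : ℝ) 1, ENNReal.ofReal |X (e t : ℝ) - Y (t : ℝ)|)

/-- Convergence of a sequence of paths for the Skorokhod topology on `[-1,1]`. -/
def SkorokhodTendsto (Xn : ℕ → ℝ → ℝ) (X : ℝ → ℝ) : Prop :=
  Tendsto (fun n => skorokhodDist (Xn n) X) atTop (𝓝 0)

/-! ### Path decomposition -/

/-- The jump of `X` at time `t`. -/
def jump (X : ℝ → ℝ) (t : ℝ) : ℝ := X t - Function.leftLim X t

/-- The strict order `s ≺ t`: `s < t` and the left limit of `X` at `s` is at most the infimum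
of `X` on `[s,t]`. -/
def Prec (X : ℝ → ℝ) (s t : ℝ) : Prop :=
  s < t ∧ Function.leftLim X s ≤ sInf (X '' Icc s t)

/-- The order `s ⪯ t`. -/
def PrecEq (X : ℝ → ℝ) (s t : ℝ) : Prop := Prec X s t ∨ s = t

open Classical in
/-- `R X s t` is the right-length `inf_{[s,t]} X - X_{s-}` if `s ≺ t`, and `0` otherwise. -/
def R (X : ℝ → ℝ) (s t : ℝ) : ℝ :=
  if Prec X s t then sInf (X '' Icc s t) - Function.leftLim X s else 0

/-- The last common ancestor of `s` and `t`. (If there is no common ancestor, which can occur only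
if `X` takes negative values, then this is `0`, the supremum of the empty set.) -/
def lastCommon (X : ℝ → ℝ) (s t : ℝ) : ℝ :=
  sSup {r : ℝ | r ∈ Icc (0 : ℝ) 1 ∧ PrecEq X r s ∧ PrecEq X r t}

/-- The dual path `X^t_s = X_{t-} - X_{(t-s)-}`. -/
def dual (X : ℝ → ℝ) (t s : ℝ) : ℝ := Function.leftLim X t - Function.leftLim X (t - s)

/-- The running supremum of the dual path. -/
def dualSup (X : ℝ → ℝ) (t s : ℝ) : ℝ := sSup (dual X t '' Icc 0 s)

/-- `J_t`: the sum of the jumps of the running supremum of the dual path on `[0,t]`; the jump at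
time `t - r` is `R X r t`. -/
def jumpPart (X : ℝ → ℝ) (t : ℝ) : ℝ :=
  ∑' r : {r : ℝ // r ∈ Icc (0 : ℝ) 1 ∧ Prec X r t}, R X r t

/-- `C_t`: the continuous part at time `t` of the running supremum of the dual path. -/
def contPart (X : ℝ → ℝ) (t : ℝ) : ℝ := dualSup X t t - jumpPart X t

/-- The pure jump property. -/
def PureJump (X : ℝ → ℝ) : Prop := ∀ t ∈ Icc (0 : ℝ) 1, contPart X t = 0

/-! ### Looptree distances -/

/-- The metric on a cycle of length `l`, which is `[0,l]` with `l` identified with `0`. -/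
def cycleDist (l a b : ℝ) : ℝ := min |a - b| (l - |a - b|)

/-- The sum of `δ_r(0, R^s_r)` over the `r` with `p < r ≺ s`. If `p ⪯ s`, then these `r` are exactly
those with `p ≺ r ≺ s`. -/
def branchSum (X : ℝ → ℝ) (p s : ℝ) : ℝ :=
  ∑' r : {r : ℝ // p < r ∧ Prec X r s}, cycleDist (jump X r) 0 (R X r s)

/-- The contribution of the cycles to the looptree distance. -/
def distLoopZero (X : ℝ → ℝ) (s t : ℝ) : ℝ :=
  cycleDist (jump X (lastCommon X s t)) (R X (lastCommon X s t) s) (R X (lastCommon X s t) t)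
    + branchSum X (lastCommon X s t) s + branchSum X (lastCommon X s t) t

/-- The tree distance coded by a function `g`. -/
def distTree (g : ℝ → ℝ) (s t : ℝ) : ℝ := g s + g t - 2 * sInf (g '' uIcc s t)

/-- The looptree distance with parameter `a`. -/
def distLoopParam (a : ℝ) (X : ℝ → ℝ) (s t : ℝ) : ℝ :=
  distLoopZero X s t + a * distTree (contPart X) s t

/-- The looptree distance on `[0,1]`. -/
def distLoop (X : ℝ → ℝ) (s t : ℝ) : ℝ := distLoopParam 1 X s t

/-! ### The looptree as a metric measured space -/

/-- Pseudo-distances on a type. -/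
structure IsPseudoDist {α : Type*} (d : α → α → ℝ) : Prop where
  self : ∀ x, d x x = 0
  symm : ∀ x y, d x y = d y x
  triangle : ∀ x y z, d x z ≤ d x y + d y z

open Classical in
/-- The pseudo-metric space defined by a pseudo-distance `d` (a trivial one if `d` is not a
pseudo-distance). -/
@[reducible]
def pseudoMetricOf {α : Type*} (d : α → α → ℝ) : PseudoMetricSpace α :=
  if h : IsPseudoDist d then
    { dist := d
      dist_self := h.self
      dist_comm := h.symm
      dist_triangle := h.triangle }
  else
    { dist := fun _ _ => 0
      dist_self := fun _ => rfl
      dist_comm := fun _ _ => rfl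
      dist_triangle := fun _ _ _ => by simp }

/-- The looptree distance on the unit interval. -/
def distUnit (X : ℝ → ℝ) (s t : unitInterval) : ℝ := distLoop X s t

/-- The interval `[0,1]`, to be equipped with the looptree distance. -/
def Time (_X : ℝ → ℝ) : Type := unitInterval

instance (X : ℝ → ℝ) : PseudoMetricSpace (Time X) :=
  pseudoMetricOf (α := unitInterval) (distUnit X)

/-- The looptree coded by `X`: the quotient of `[0,1]` by the relation `distLoop X s t = 0`. -/
def Loop (X : ℝ → ℝ) : Type := SeparationQuotient (Time X)

instance (X : ℝ → ℝ) : MetricSpace (Loop X) :=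
  inferInstanceAs (MetricSpace (SeparationQuotient (Time X)))

instance (X : ℝ → ℝ) : MeasurableSpace (Loop X) := borel (Loop X)

instance (X : ℝ → ℝ) : BorelSpace (Loop X) := ⟨rfl⟩

/-- The canonical projection of `[0,1]` onto the looptree. -/
def proj (X : ℝ → ℝ) (s : unitInterval) : Loop X :=
  SeparationQuotient.mk (X := Time X) s

/-- The uniform measure on the looptree: the push-forward of the Lebesgue measure on `[0,1]`. -/
def loopMeasure (X : ℝ → ℝ) : Measure (Loop X) :=
  Measure.map (proj X) (volume : Measure unitInterval)

/-- The distance between two projected times is the looptree distance. -/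
theorem dist_proj (X : ℝ → ℝ) (h : IsPseudoDist (distUnit X)) (s t : unitInterval) :
    dist (proj X s) (proj X t) = distLoop X s t := by
  have h1 : dist (proj X s) (proj X t)
      = (pseudoMetricOf (α := unitInterval) (distUnit X)).dist s t := rfl
  rw [h1, pseudoMetricOf, dif_pos h]
  rfl

/-! ### The Gromov–Hausdorff–Prokhorov distance -/

/-- `ε` is admissible for `(α, μ)` and `(β, μ')` if there are a coupling `ν` of `μ` and `μ'` and a
compact correspondence `C` with `ν C ≥ 1 - ε` and distortion at most `2 ε`. -/
def GHPAdmissible {α β : Type*} [MetricSpace α] [MeasurableSpace α] [MetricSpace β]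
    [MeasurableSpace β] (μ : Measure α) (μ' : Measure β) (ε : ℝ) : Prop :=
  ∃ (ν : Measure (α × β)) (C : Set (α × β)),
    Measure.map Prod.fst ν = μ ∧ Measure.map Prod.snd ν = μ' ∧
    IsCompact C ∧ (∀ x, ∃ y, (x, y) ∈ C) ∧ (∀ y, ∃ x, (x, y) ∈ C) ∧
    ENNReal.ofReal (1 - ε) ≤ ν C ∧
    ∀ p ∈ C, ∀ q ∈ C, |dist p.1 q.1 - dist p.2 q.2| ≤ 2 * ε

/-- The Gromov–Hausdorff–Prokhorov distance. -/
def ghpDist {α β : Type*} [MetricSpace α] [MeasurableSpace α] [MetricSpace β]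
    [MeasurableSpace β] (μ : Measure α) (μ' : Measure β) : ℝ≥0∞ :=
  ⨅ (ε : ℝ) (_ : 0 < ε ∧ GHPAdmissible μ μ' ε), ENNReal.ofReal ε

end Looptree

end

namespace Looptree

/-! ### Infima and left limits of paths -/

/-! The looptree distance is first rewritten, on `[0,1]`, as the sum over all cycles `r` of
`δ_r(R^s_r, R^t_r)` plus the tree distance coded by `C` (`IsPath.distLoop_eq`). The last common
ancestor, which behaves badly in `s` and `t`, disappears, and each cycle can be treated separately.

The lengths `R^t_r`, `r < t`, are lengths of disjoint intervals between `inf_{[-1,t]} X` and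
`X_{t-}`. Their sum is therefore at most the height `H_t = X_{t-} - inf_{[-1,t]} X`, and `C_t` is
the missing length. Moving from `s` to `t` changes the lengths, apart from that of `r = s`, by at
most `osc X s t` in total (`IsPath.sum_abs_R_sub_le`). This gives continuity of `C` and of the
distance; a compactness argument then gives a finite set `F` of cycles outside which the lengths
`R^t_r` have small sum, uniformly in `t` (`IsPath.exists_tailSum_le`).

Let `Y` be close to `X` after a time change. Heights are close, and so are the finitely many lengths
in `F`. Under (PJ) the lengths in `F` nearly exhaust the height of `X`, so in `Y` little is left for
the other cycles and for `C` together (`tailSum_shift_add_contPart_le`). This is why (PJ) is needed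
for the limit only. The distances thus differ little on `F` and are negligible elsewhere; uniform
continuity of the limit distance removes the time change. Uniform closeness gives GHP closeness
through the common parametrization by `[0,1]`.

Sums run over `(-1,1]`, which every time change preserves, whereas `[0,1]` need not be preserved;
negative indices contribute nothing. -/

/-- The infimum of `X` on `[s,t]`. -/
noncomputable def infOn (X : ℝ → ℝ) (s t : ℝ) : ℝ := sInf (X '' Icc s t)

section Path

variable {X : ℝ → ℝ} {r s t u c : ℝ}

theorem IsPath.tendsto_leftLim (h : IsPath X) (ht : t ∈ Ioc (-1 : ℝ) 1) :
    Tendsto X (𝓝[<] t) (𝓝 (Function.leftLim X t)) := by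
  rcases lt_or_ge 0 t with h0 | h0
  · exact tendsto_leftLim_of_tendsto (h.left_lim t ⟨h0, ht.2⟩)
  · refine tendsto_leftLim_of_tendsto ⟨0, ?_⟩
    refine tendsto_const_nhds.congr' ?_
    filter_upwards [Ioo_mem_nhdsLT ht.1] with u hu
    exact (h.zero_before u ⟨hu.1.le, hu.2.trans_le h0⟩).symm

theorem IsPath.leftLim_of_nonpos (h : IsPath X) (ht : -1 < t) (h0 : t ≤ 0) :
    Function.leftLim X t = 0 := by
  refine tendsto_nhds_unique (h.tendsto_leftLim ⟨ht, h0.trans zero_le_one⟩) ?_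
  refine tendsto_const_nhds.congr' ?_
  filter_upwards [Ioo_mem_nhdsLT ht] with u hu
  exact (h.zero_before u ⟨hu.1.le, hu.2.trans_le h0⟩).symm

theorem IsPath.leftLim_le (h : IsPath X) (ht : t ∈ Ioc (-1 : ℝ) 1) :
    Function.leftLim X t ≤ X t := by
  rcases lt_or_ge t 0 with h0 | h0
  · rw [h.leftLim_of_nonpos ht.1 h0.le, h.zero_before t ⟨ht.1.le, h0⟩]
  · exact h.no_neg_jump t ⟨h0, ht.2⟩

theorem IsPath.tendsto_right (h : IsPath X) (h1 : -1 ≤ t) (h2 : t < 1) :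
    Tendsto X (𝓝[≥] t) (𝓝 (X t)) := by
  rcases lt_or_ge t 0 with h0 | h0
  · refine tendsto_const_nhds.congr' ?_
    filter_upwards [Ico_mem_nhdsGE h0] with u hu
    rw [h.zero_before u ⟨h1.trans hu.1, hu.2⟩, h.zero_before t ⟨h1, h0⟩]
  · exact h.right_cont t ⟨h0, h2⟩

theorem IsPath.bddBelow (h : IsPath X) : BddBelow (X '' Icc (-1) 1) := by
  refine isCompact_Icc.induction_on (p := fun S => BddBelow (X '' S)) (by simp)
    (fun S T hST hT => hT.mono (image_mono hST))
    (fun S T hS hT => by rw [image_union]; exact hS.union hT) ?_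
  intro t ht
  have hr : ∃ S ∈ 𝓝[≥] t ⊓ 𝓟 (Icc (-1 : ℝ) 1), BddBelow (X '' S) := by
    rcases ht.2.lt_or_eq with h1 | rfl
    · exact ⟨_, mem_inf_of_left ((h.tendsto_right ht.1 h1) (Ioi_mem_nhds (sub_one_lt (X t)))),
        X t - 1, by rintro _ ⟨u, hu, rfl⟩; exact (show X t - 1 < X u from hu).le⟩
    · refine ⟨{1}, ?_, by simp⟩
      filter_upwards [mem_inf_of_left self_mem_nhdsWithin, mem_inf_of_right (mem_principal_self _)]
        with u hu hu'
      exact le_antisymm hu'.2 hu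
  have hl : ∃ S ∈ 𝓝[<] t ⊓ 𝓟 (Icc (-1 : ℝ) 1), BddBelow (X '' S) := by
    rcases ht.1.lt_or_eq with h1 | rfl
    · exact ⟨_, mem_inf_of_left ((h.tendsto_leftLim ⟨h1, ht.2⟩)
        (Ioi_mem_nhds (sub_one_lt (Function.leftLim X t)))), Function.leftLim X t - 1, by
          rintro _ ⟨u, hu, rfl⟩; exact (show Function.leftLim X t - 1 < X u from hu).le⟩
    · refine ⟨∅, ?_, by simp⟩
      filter_upwards [mem_inf_of_left self_mem_nhdsWithin, mem_inf_of_right (mem_principal_self _)]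
        with u hu hu'
      exact absurd (show u < -1 from hu) (not_lt.2 hu'.1)
  obtain ⟨S, hS, hSb⟩ := hr
  obtain ⟨T, hT, hTb⟩ := hl
  refine ⟨T ∪ S, ?_, by rw [image_union]; exact hTb.union hSb⟩
  have : 𝓝[Icc (-1 : ℝ) 1] t
      = (𝓝[<] t ⊓ 𝓟 (Icc (-1 : ℝ) 1)) ⊔ (𝓝[≥] t ⊓ 𝓟 (Icc (-1 : ℝ) 1)) := by
    rw [← inf_sup_right, nhdsLT_sup_nhdsGE, nhdsWithin]
  rw [this]
  exact union_mem_sup hT hS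

theorem IsPath.infOn_le (h : IsPath X) (hs : -1 ≤ s) (ht : t ≤ 1) (hu : u ∈ Icc s t) :
    infOn X s t ≤ X u :=
  csInf_le (h.bddBelow.mono (image_mono (Icc_subset_Icc hs ht))) (mem_image_of_mem _ hu)

theorem le_infOn (hst : s ≤ t) (hc : ∀ u ∈ Icc s t, c ≤ X u) : c ≤ infOn X s t :=
  le_csInf ((nonempty_Icc.2 hst).image _) (by rintro _ ⟨u, hu, rfl⟩; exact hc u hu)

theorem IsPath.infOn_eq_min (h : IsPath X) (hs : -1 ≤ s) (hsu : s ≤ u) (hut : u ≤ t)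
    (ht : t ≤ 1) : infOn X s t = min (infOn X s u) (infOn X u t) := by
  refine le_antisymm (le_min ?_ ?_) ?_
  · exact le_infOn hsu fun v hv => h.infOn_le hs ht ⟨hv.1, hv.2.trans hut⟩
  · exact le_infOn hut fun v hv => h.infOn_le hs ht ⟨hsu.trans hv.1, hv.2⟩
  · refine le_infOn (hsu.trans hut) fun v hv => ?_
    rcases le_total v u with hvu | hvu
    · exact (min_le_left _ _).trans (h.infOn_le hs (hut.trans ht) ⟨hv.1, hvu⟩)
    · exact (min_le_right _ _).trans (h.infOn_le (hs.trans hsu) ht ⟨hvu, hv.2⟩)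

theorem IsPath.infOn_le_leftLim (h : IsPath X) (hs : -1 ≤ s) (hsu : s < u) (hut : u ≤ t)
    (ht : t ≤ 1) : infOn X s t ≤ Function.leftLim X u := by
  refine ge_of_tendsto (h.tendsto_leftLim ⟨hs.trans_lt hsu, hut.trans ht⟩) ?_
  filter_upwards [Ioo_mem_nhdsLT hsu] with v hv
  exact h.infOn_le hs ht ⟨hv.1.le, hv.2.le.trans hut⟩

/-- The size of the variations of the path coding the geodesic from `s` to `t`. -/
noncomputable def osc (X : ℝ → ℝ) (s t : ℝ) : ℝ :=
  max (Function.leftLim X s - infOn X s t) 0 + (Function.leftLim X t - infOn X s t)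

theorem IsPath.osc_nonneg (h : IsPath X) (hs : -1 ≤ s) (hst : s < t) (ht : t ≤ 1) :
    0 ≤ osc X s t :=
  add_nonneg (le_max_right _ _) (sub_nonneg.2 (h.infOn_le_leftLim hs hst le_rfl ht))

theorem IsPath.eventually_left (h : IsPath X) (ht : t ∈ Ioc (-1 : ℝ) 1) {ε : ℝ} (hε : 0 < ε) :
    ∀ᶠ s in 𝓝[<] t, osc X s t ≤ ε ∧ |infOn X s t - Function.leftLim X s| ≤ ε := by
  have h1 : ∀ᶠ s in 𝓝[<] t, |X s - Function.leftLim X t| < ε / 3 := by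
    simpa [Real.dist_eq] using Metric.tendsto_nhds.1 (h.tendsto_leftLim ht) (ε / 3) (by positivity)
  obtain ⟨l, hl, hlt⟩ := (mem_nhdsLT_iff_exists_Ioo_subset' ht.1).1 h1
  filter_upwards [Ioo_mem_nhdsLT (max_lt hl ht.1)] with s hs
  have hs1 : -1 < s := (le_max_right _ _).trans_lt hs.1
  have hsl : l < s := (le_max_left _ _).trans_lt hs.1
  have hX : ∀ u, l < u → u < t → |X u - Function.leftLim X t| < ε / 3 :=
    fun u hu hut => hlt ⟨hu, hut⟩
  have hx : |Function.leftLim X s - Function.leftLim X t| ≤ ε / 3 := by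
    refine le_of_tendsto ((h.tendsto_leftLim ⟨hs1, hs.2.le.trans ht.2⟩).sub_const _).abs ?_
    filter_upwards [Ioo_mem_nhdsLT hsl] with u hu
    exact (hX u hu.1 (hu.2.trans hs.2)).le
  have hm : infOn X s t ≤ Function.leftLim X t := h.infOn_le_leftLim hs1.le hs.2 le_rfl ht.2
  have hm' : Function.leftLim X t - ε / 3 ≤ infOn X s t := by
    refine le_infOn hs.2.le fun u hu => ?_
    rcases hu.2.lt_or_eq with hut | rfl
    · have := abs_lt.1 (hX u (hsl.trans_le hu.1) hut)
      linarith
    · linarith [h.leftLim_le ht]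
  have hx := abs_le.1 hx
  refine ⟨?_, abs_le.2 ⟨by linarith, by linarith⟩⟩
  have : max (Function.leftLim X s - infOn X s t) 0 ≤ 2 * ε / 3 := max_le (by linarith) (by linarith)
  unfold osc
  linarith

/-- As `s` decreases to `t`, `X_{t-} - inf_{[t,s]} X` tends to `-ΔX_t ≤ 0`: the absence of negative
jumps kills the positive part in `osc`. The length `R^s_t` itself tends to `ΔX_t`, so on this side
it is the remainder `X_t - inf_{[t,s]} X` that is small. -/
theorem IsPath.eventually_right (h : IsPath X) (ht : t ∈ Ioo (-1 : ℝ) 1) {ε : ℝ} (hε : 0 < ε) :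
    ∀ᶠ s in 𝓝[>] t, osc X t s ≤ ε ∧ |X t - infOn X t s| ≤ ε := by
  have h1 : ∀ᶠ s in 𝓝[≥] t, |X s - X t| < ε / 3 := by
    simpa [Real.dist_eq] using
      Metric.tendsto_nhds.1 (h.tendsto_right ht.1.le ht.2) (ε / 3) (by positivity)
  obtain ⟨l, hl, hlt⟩ := (mem_nhdsGE_iff_exists_Ico_subset' ht.2).1 h1
  filter_upwards [Ioo_mem_nhdsGT (lt_min hl ht.2)] with s hs
  have hs1 : s < 1 := hs.2.trans_le (min_le_right _ _)
  have hsl : s < l := hs.2.trans_le (min_le_left _ _)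
  have hX : ∀ u, t ≤ u → u < l → |X u - X t| < ε / 3 := fun u hu hut => hlt ⟨hu, hut⟩
  have hx : |Function.leftLim X s - X t| ≤ ε / 3 := by
    refine le_of_tendsto ((h.tendsto_leftLim ⟨ht.1.trans hs.1, hs1.le⟩).sub_const _).abs ?_
    filter_upwards [Ioo_mem_nhdsLT hs.1] with u hu
    exact (hX u hu.1.le (hu.2.trans hsl)).le
  have hm : infOn X t s ≤ X t := h.infOn_le ht.1.le hs1.le ⟨le_rfl, hs.1.le⟩
  have hm' : X t - ε / 3 ≤ infOn X t s := by
    refine le_infOn hs.1.le fun u hu => ?_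
    have := abs_lt.1 (hX u hu.1 (hu.2.trans_lt hsl))
    linarith
  have hx := abs_le.1 hx
  have hjump := h.leftLim_le (t := t) ⟨ht.1, ht.2.le⟩
  refine ⟨?_, abs_le.2 ⟨by linarith, by linarith⟩⟩
  have : max (Function.leftLim X t - infOn X t s) 0 ≤ ε / 3 := max_le (by linarith) (by linarith)
  unfold osc
  linarith

/-- A criterion of continuity for quantities controlled by `osc`. -/
theorem IsPath.eventually_le_of_osc (h : IsPath X) (ht : t ∈ Ioc (-1 : ℝ) 1) {D : ℝ → ℝ}
    (h0 : D t ≤ 0)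
    (hl : ∀ s ∈ Ioc (-1 : ℝ) 1, s < t →
      D s ≤ 2 * osc X s t + |infOn X s t - Function.leftLim X s|)
    (hr : ∀ s ∈ Ioc (-1 : ℝ) 1, t < s → D s ≤ 2 * osc X t s + |X t - infOn X t s|)
    {ε : ℝ} (hε : 0 < ε) : ∀ᶠ s in 𝓝[Ioc (-1 : ℝ) 1] t, D s ≤ ε := by
  have hε' : 0 < ε / 3 := by positivity
  have h1 : ∀ᶠ s in 𝓝[<] t, s ∈ Ioc (-1 : ℝ) 1 → D s ≤ ε := by
    filter_upwards [h.eventually_left ht hε', self_mem_nhdsWithin] with s hs hst hs1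
    linarith [hl s hs1 hst, hs.1, hs.2]
  have h2 : ∀ᶠ s in 𝓝[>] t, s ∈ Ioc (-1 : ℝ) 1 → D s ≤ ε := by
    rcases ht.2.lt_or_eq with h1 | rfl
    · filter_upwards [h.eventually_right ⟨ht.1, h1⟩ hε', self_mem_nhdsWithin] with s hs hst hs1
      linarith [hr s hs1 hst, hs.1, hs.2]
    · filter_upwards [self_mem_nhdsWithin] with s hs hs1
      exact absurd hs1.2 (not_le.2 hs)
  have h3 : ∀ᶠ s in 𝓝 t, s ∈ Ioc (-1 : ℝ) 1 → D s ≤ ε := by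
    rw [← nhdsLT_sup_nhdsGE, ← Ioi_insert, nhdsWithin_insert]
    exact eventually_sup.2 ⟨h1, eventually_sup.2 ⟨eventually_pure.2 fun _ => h0.trans hε.le, h2⟩⟩
  exact eventually_nhdsWithin_iff.2 h3

end Path

/-! ### Right-lengths -/

/-- The intervals `[lo r, hi r]` are stacked without overlap inside `[c, U]`. All bounds on sums of
right-lengths come from this. -/
theorem sum_gap_le {ι : Type*} [LinearOrder ι] (A : Finset ι) (lo hi : ι → ℝ) {c U : ℝ}
    (hc : ∀ r ∈ A, c ≤ lo r) (hU : ∀ r ∈ A, hi r ≤ U) (hcU : c ≤ U)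
    (hmono : ∀ r ∈ A, ∀ r' ∈ A, r < r' → hi r ≤ lo r') :
    ∑ r ∈ A, (hi r - lo r) ≤ U - c := by
  induction A using Finset.induction_on_max generalizing U with
  | empty => simpa using hcU
  | insert a A ha ih =>
    rw [Finset.sum_insert fun h => lt_irrefl a (ha a h)]
    have := ih (U := lo a) (fun r hr => hc r (Finset.mem_insert_of_mem hr))
      (fun r hr => hmono r (Finset.mem_insert_of_mem hr) a (Finset.mem_insert_self _ _) (ha r hr))
      (hc a (Finset.mem_insert_self _ _))
      (fun r hr r' hr' => hmono r (Finset.mem_insert_of_mem hr) r' (Finset.mem_insert_of_mem hr'))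
    linarith [hU a (Finset.mem_insert_self _ _)]

section Path

variable {X : ℝ → ℝ} {r s t u c : ℝ}

theorem R_eq (X : ℝ → ℝ) (hrt : r < t) :
    R X r t = max (infOn X r t - Function.leftLim X r) 0 := by
  unfold R
  split_ifs with h
  · exact (max_eq_left (sub_nonneg.2 h.2)).symm
  · exact (max_eq_right (sub_nonpos.2 (not_le.1 fun h' => h ⟨hrt, h'⟩).le)).symm

theorem R_eq_zero_of_le (X : ℝ → ℝ) (hrt : t ≤ r) : R X r t = 0 :=
  if_neg fun h => absurd h.1 (not_lt.2 hrt)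

theorem R_eq_zero_of_not_prec (hrt : ¬ Prec X r t) : R X r t = 0 := if_neg hrt

theorem R_nonneg (X : ℝ → ℝ) (r t : ℝ) : 0 ≤ R X r t := by
  rcases lt_or_ge r t with h | h
  · rw [R_eq X h]; exact le_max_right _ _
  · rw [R_eq_zero_of_le X h]

/-- The right-length as a gap. -/
theorem R_eq_sub (X : ℝ → ℝ) (hrt : r < t) :
    R X r t = infOn X r t - min (Function.leftLim X r) (infOn X r t) := by
  rw [R_eq X hrt]
  rcases le_total (Function.leftLim X r) (infOn X r t) with h | h
  · rw [min_eq_left h, max_eq_left (sub_nonneg.2 h)]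
  · rw [min_eq_right h, max_eq_right (sub_nonpos.2 h), sub_self]

theorem IsPath.jump_nonneg (h : IsPath X) (hr : r ∈ Ioc (-1 : ℝ) 1) : 0 ≤ jump X r :=
  sub_nonneg.2 (h.leftLim_le hr)

theorem IsPath.R_le_jump (h : IsPath X) (hr : r ∈ Ioc (-1 : ℝ) 1) (ht : t ≤ 1) :
    R X r t ≤ jump X r := by
  rcases lt_or_ge r t with hrt | hrt
  · rw [R_eq X hrt]
    refine max_le ?_ (h.jump_nonneg hr)
    have := h.infOn_le hr.1.le ht ⟨le_rfl, hrt.le⟩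
    unfold jump
    linarith
  · rw [R_eq_zero_of_le X hrt]
    exact h.jump_nonneg hr

theorem IsPath.R_eq_zero_of_neg (h : IsPath X) (hr : -1 < r) (hr0 : r < 0) (ht : t ≤ 1) :
    R X r t = 0 := by
  rcases lt_or_ge r t with hrt | hrt
  · rw [R_eq X hrt, h.leftLim_of_nonpos hr hr0.le, sub_zero, max_eq_right]
    exact (h.infOn_le hr.le ht ⟨le_rfl, hrt.le⟩).trans_eq (h.zero_before r ⟨hr.le, hr0⟩)
  · exact R_eq_zero_of_le X hrt

theorem IsPath.R_max_zero (h : IsPath X) (hr : -1 < r) (ht : t ≤ 1) :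
    R X r (max t 0) = R X r t := by
  rcases le_total 0 t with ht0 | ht0
  · rw [max_eq_left ht0]
  · rw [max_eq_right ht0]
    rcases lt_or_ge r 0 with hr0 | hr0
    · rw [h.R_eq_zero_of_neg hr hr0 zero_le_one, h.R_eq_zero_of_neg hr hr0 ht]
    · rw [R_eq_zero_of_le X hr0, R_eq_zero_of_le X (ht0.trans hr0)]

/-- The height of `t`, that is the terminal value of the running supremum of the dual path. -/
noncomputable def height (X : ℝ → ℝ) (t : ℝ) : ℝ := Function.leftLim X t - infOn X (-1) t

theorem IsPath.sum_R_le (h : IsPath X) (ht : t ∈ Ioc (-1 : ℝ) 1)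
    (A : Finset (Ioc (-1 : ℝ) 1)) : ∑ r ∈ A, R X r t ≤ height X t := by
  have h1 : ∑ r ∈ A, R X r t = ∑ r ∈ A.filter (fun r : Ioc (-1 : ℝ) 1 => (r : ℝ) < t),
      (infOn X r t - min (Function.leftLim X r) (infOn X r t)) := by
    rw [← Finset.sum_filter_add_sum_filter_not A (fun r : Ioc (-1 : ℝ) 1 => (r : ℝ) < t),
      Finset.sum_congr rfl fun r hr => R_eq_sub X (Finset.mem_filter.1 hr).2,
      Finset.sum_eq_zero (s := A.filter (fun r : Ioc (-1 : ℝ) 1 => ¬ (r : ℝ) < t)) fun r hr =>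
        R_eq_zero_of_le X (not_lt.1 (Finset.mem_filter.1 hr).2), add_zero]
  rw [h1]
  refine sum_gap_le _ _ _ (fun r hr => ?_) (fun r hr => ?_)
    (h.infOn_le_leftLim le_rfl ht.1 le_rfl ht.2) (fun r hr r' hr' hrr => ?_)
  · have hrt := (Finset.mem_filter.1 hr).2
    refine le_min (h.infOn_le_leftLim le_rfl r.2.1 hrt.le ht.2) ?_
    rw [h.infOn_eq_min le_rfl r.2.1.le hrt.le ht.2]
    exact min_le_right _ _
  · exact h.infOn_le_leftLim r.2.1.le (Finset.mem_filter.1 hr).2 le_rfl ht.2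
  · have hrt := (Finset.mem_filter.1 hr').2
    refine le_min (h.infOn_le_leftLim r.2.1.le hrr hrt.le ht.2) ?_
    rw [h.infOn_eq_min r.2.1.le (show (r : ℝ) ≤ r' from hrr.le) hrt.le ht.2]
    exact min_le_right _ _

/-- Passing from `s` to `t` truncates the interval of `r` at the level `inf_{[s,t]} X`; what is lost
is its part above that level. -/
theorem IsPath.R_sub_eq (h : IsPath X) (hr : -1 < r) (hrs : r < s) (hst : s < t) (ht : t ≤ 1) :
    R X r s - R X r t = max (infOn X r s) (infOn X s t)
      - max (min (Function.leftLim X r) (infOn X r s)) (infOn X s t) := by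
  rw [R_eq_sub X hrs, R_eq_sub X (hrs.trans hst), h.infOn_eq_min hr.le hrs.le hst.le ht,
    ← min_assoc]
  linarith [min_add_max (infOn X r s) (infOn X s t),
    min_add_max (min (Function.leftLim X r) (infOn X r s)) (infOn X s t)]

/-- Ancestors `r < s` lose disjoint intervals between `inf_{[s,t]} X` and `X_{s-}`; those with `s <
r < t` are new, with disjoint intervals between `inf_{[s,t]} X` and `X_{t-}`. The index `s` is
excluded because `R^t_s` can be as large as the jump at `s`. -/
theorem IsPath.sum_abs_R_sub_le (h : IsPath X) (hs : s ∈ Ioc (-1 : ℝ) 1)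
    (ht : t ∈ Ioc (-1 : ℝ) 1) (hst : s < t) (A : Finset (Ioc (-1 : ℝ) 1))
    (hA : (⟨s, hs⟩ : Ioc (-1 : ℝ) 1) ∉ A) : ∑ r ∈ A, |R X r s - R X r t| ≤ osc X s t := by
  have h1 : ∑ r ∈ A.filter (fun r : Ioc (-1 : ℝ) 1 => (r : ℝ) < s), |R X r s - R X r t|
      ≤ max (Function.leftLim X s - infOn X s t) 0 := by
    have h1 : max (Function.leftLim X s - infOn X s t) 0
        = max (Function.leftLim X s) (infOn X s t) - infOn X s t := by
      rw [← max_sub_sub_right, sub_self]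
    rw [h1]
    rw [Finset.sum_congr rfl (g := fun r : Ioc (-1 : ℝ) 1 => max (infOn X r s) (infOn X s t)
      - max (min (Function.leftLim X r) (infOn X r s)) (infOn X s t))]
    · refine sum_gap_le _ _ _ (fun r hr => le_max_right _ _) (fun r hr => ?_)
        (le_max_right _ _) (fun r hr r' hr' hrr => ?_)
      · exact max_le_max_right _
          (h.infOn_le_leftLim r.2.1.le (Finset.mem_filter.1 hr).2 le_rfl hs.2)
      · have hrt := (Finset.mem_filter.1 hr').2
        refine max_le_max_right _ (le_min (h.infOn_le_leftLim r.2.1.le hrr hrt.le hs.2) ?_)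
        rw [h.infOn_eq_min r.2.1.le (show (r : ℝ) ≤ r' from hrr.le) hrt.le hs.2]
        exact min_le_right _ _
    · intro r hr
      rw [h.R_sub_eq r.2.1 (Finset.mem_filter.1 hr).2 hst ht.2, abs_of_nonneg]
      exact sub_nonneg.2 (max_le_max_right _ (min_le_right _ _))
  have h2 : ∑ r ∈ A.filter (fun r : Ioc (-1 : ℝ) 1 => ¬ (r : ℝ) < s), |R X r s - R X r t|
      ≤ Function.leftLim X t - infOn X s t := by
    rw [← Finset.sum_filter_add_sum_filter_not _ (fun r : Ioc (-1 : ℝ) 1 => (r : ℝ) < t),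
      Finset.sum_eq_zero (s := Finset.filter (fun r : Ioc (-1 : ℝ) 1 => ¬ (r : ℝ) < t) _), add_zero,
      Finset.sum_congr rfl (g := fun r : Ioc (-1 : ℝ) 1 =>
        infOn X r t - min (Function.leftLim X r) (infOn X r t))]
    · have key : ∀ r ∈ (A.filter (fun r : Ioc (-1 : ℝ) 1 => ¬ (r : ℝ) < s)).filter
          (fun r : Ioc (-1 : ℝ) 1 => (r : ℝ) < t), s < r ∧ r < t := fun r hr => by
        simp only [Finset.mem_filter, not_lt] at hr
        refine ⟨hr.1.2.lt_of_ne ?_, hr.2⟩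
        rintro rfl
        exact hA hr.1.1
      refine sum_gap_le _ _ _ (fun r hr => ?_) (fun r hr => ?_)
        (h.infOn_le_leftLim hs.1.le hst le_rfl ht.2) (fun r hr r' hr' hrr => ?_)
      · obtain ⟨hsr, hrt⟩ := key r hr
        refine le_min (h.infOn_le_leftLim hs.1.le hsr hrt.le ht.2) ?_
        rw [h.infOn_eq_min hs.1.le hsr.le hrt.le ht.2]
        exact min_le_right _ _
      · exact h.infOn_le_leftLim r.2.1.le (key r hr).2 le_rfl ht.2
      · have hrt := (key r' hr').2
        refine le_min (h.infOn_le_leftLim r.2.1.le hrr hrt.le ht.2) ?_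
        rw [h.infOn_eq_min r.2.1.le (show (r : ℝ) ≤ r' from hrr.le) hrt.le ht.2]
        exact min_le_right _ _
    · intro r hr
      simp only [Finset.mem_filter, not_lt] at hr
      rw [R_eq_zero_of_le X hr.1.2, zero_sub, abs_neg, abs_of_nonneg (R_nonneg X r t),
        R_eq_sub X hr.2]
    · intro r hr
      simp only [Finset.mem_filter, not_lt] at hr
      rw [R_eq_zero_of_le X hr.1.2, R_eq_zero_of_le X hr.2, sub_self, abs_zero]
  rw [← Finset.sum_filter_add_sum_filter_not A (fun r : Ioc (-1 : ℝ) 1 => (r : ℝ) < s)]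
  exact add_le_add h1 h2

theorem IsPath.summable_R (h : IsPath X) (ht : t ∈ Ioc (-1 : ℝ) 1) :
    Summable fun r : Ioc (-1 : ℝ) 1 => R X r t :=
  summable_of_sum_le (fun r => R_nonneg X r t) (h.sum_R_le ht)

end Path

/-! ### The metric of a cycle -/

theorem cycleDist_self {l : ℝ} (hl : 0 ≤ l) (a : ℝ) : cycleDist l a a = 0 := by
  simp [cycleDist, hl]

theorem cycleDist_comm (l a b : ℝ) : cycleDist l a b = cycleDist l b a := by
  simp [cycleDist, abs_sub_comm]

theorem cycleDist_le (l a b : ℝ) : cycleDist l a b ≤ |a - b| := min_le_left _ _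

theorem cycleDist_nonneg {l a b : ℝ} (ha : a ∈ Icc 0 l) (hb : b ∈ Icc 0 l) :
    0 ≤ cycleDist l a b :=
  le_min (abs_nonneg _) (sub_nonneg.2 (abs_le.2 ⟨by linarith [ha.1, hb.2], by linarith [ha.2, hb.1]⟩))

theorem cycleDist_triangle {l a b c : ℝ} (ha : a ∈ Icc 0 l) (hb : b ∈ Icc 0 l)
    (hc : c ∈ Icc 0 l) : cycleDist l a c ≤ cycleDist l a b + cycleDist l b c := by
  obtain ⟨ha0, hal⟩ := ha
  obtain ⟨hb0, hbl⟩ := hb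
  obtain ⟨hc0, hcl⟩ := hc
  have h1 := min_le_left |a - c| (l - |a - c|)
  have h2 := min_le_right |a - c| (l - |a - c|)
  unfold cycleDist
  rcases abs_cases (a - b) with ⟨e1, _⟩ | ⟨e1, _⟩ <;>
  rcases abs_cases (b - c) with ⟨e2, _⟩ | ⟨e2, _⟩ <;>
  rcases abs_cases (a - c) with ⟨e3, _⟩ | ⟨e3, _⟩ <;>
  rw [e3] at h1 h2 <;> rw [e1, e2, e3] <;>
  rcases min_cases (a - b) (l - (a - b)) with ⟨e4, _⟩ | ⟨e4, _⟩ <;>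
  rcases min_cases (-(a - b)) (l - -(a - b)) with ⟨e5, _⟩ | ⟨e5, _⟩ <;>
  rcases min_cases (b - c) (l - (b - c)) with ⟨e6, _⟩ | ⟨e6, _⟩ <;>
  rcases min_cases (-(b - c)) (l - -(b - c)) with ⟨e7, _⟩ | ⟨e7, _⟩ <;>
  simp only [e4, e5, e6, e7] <;> linarith

theorem cycleDist_sub_le (l l' a a' b b' : ℝ) :
    |cycleDist l a b - cycleDist l' a' b'| ≤ |l - l'| + |a - a'| + |b - b'| := by
  have h : |(|a - b|) - (|a' - b'|)| ≤ |a - a'| + |b - b'| := by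
    refine (abs_abs_sub_abs_le _ _).trans ?_
    rw [show a - b - (a' - b') = (a - a') - (b - b') by ring]
    exact abs_sub _ _
  refine (abs_min_sub_min_le_max _ _ _ _).trans (max_le ?_ ?_)
  · linarith [abs_nonneg (l - l')]
  · rw [show l - |a - b| - (l' - |a' - b'|) = (l - l') - (|a - b| - |a' - b'|) by ring]
    exact (abs_sub _ _).trans (by linarith)

/-! ### Tails of series -/

theorem abs_tsum_sub_sum_le {ι : Type*} [DecidableEq ι] {f g : ι → ℝ} (hf : Summable f)
    (hg : Summable g) (F : Finset ι) {K : ℝ}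
    (hK : ∀ A : Finset ι, Disjoint A F → ∑ r ∈ A, |f r - g r| ≤ K) :
    |(∑' r, f r - ∑ r ∈ F, f r) - (∑' r, g r - ∑ r ∈ F, g r)| ≤ K := by
  have h1 : Tendsto (fun A : Finset ι => |∑ r ∈ A, (f r - g r) - ∑ r ∈ F, (f r - g r)|) atTop
      (𝓝 |∑' r, (f r - g r) - ∑ r ∈ F, (f r - g r)|) :=
    ((hf.sub hg).hasSum.sub_const _).abs
  rw [hf.tsum_sub hg, Finset.sum_sub_distrib] at h1
  rw [show ∀ a b c d : ℝ, a - b - (c - d) = a - c - (b - d) by intros; ring]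
  refine le_of_tendsto h1 ?_
  filter_upwards [eventually_ge_atTop F] with A hA
  rw [← Finset.sum_sub_distrib, ← Finset.sum_sdiff hA, add_sub_cancel_right]
  exact (Finset.abs_sum_le_sum_abs _ _).trans (hK _ Finset.sdiff_disjoint)

theorem tsum_sub_sum_le {ι : Type*} {f g : ι → ℝ} (hf : Summable f) (hg : Summable g)
    (hfg : ∀ r, f r ≤ g r) (F : Finset ι) :
    ∑' r, f r - ∑ r ∈ F, f r ≤ ∑' r, g r - ∑ r ∈ F, g r := by
  have := (hg.sub hf).sum_le_tsum F fun r _ => sub_nonneg.2 (hfg r)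
  rw [hg.tsum_sub hf, Finset.sum_sub_distrib] at this
  linarith

/-! ### The continuous part -/

section Path

variable {X : ℝ → ℝ} {r s t u c : ℝ}

/-- The sum of the right-lengths of the ancestors of `t`. -/
noncomputable def jumpSum (X : ℝ → ℝ) (t : ℝ) : ℝ := ∑' r : Ioc (-1 : ℝ) 1, R X r t

/-- The part of `jumpSum X t` that is carried by the ancestors out of `F`. -/
noncomputable def tailSum (X : ℝ → ℝ) (F : Finset (Ioc (-1 : ℝ) 1)) (t : ℝ) : ℝ :=
  jumpSum X t - ∑ r ∈ F, R X r t

theorem IsPath.jumpPart_eq (h : IsPath X) (ht : t ∈ Icc (0 : ℝ) 1) : jumpPart X t = jumpSum X t := by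
  unfold jumpPart jumpSum
  refine (tsum_subtype {r : ℝ | r ∈ Icc (0 : ℝ) 1 ∧ Prec X r t} (fun r => R X r t)).trans ?_
  rw [tsum_subtype (Ioc (-1 : ℝ) 1) (fun r => R X r t)]
  refine tsum_congr fun r => ?_
  by_cases hr : r ∈ Icc (0 : ℝ) 1 ∧ Prec X r t
  · rw [indicator_of_mem (show r ∈ {r : ℝ | r ∈ Icc (0 : ℝ) 1 ∧ Prec X r t} from hr),
      indicator_of_mem (show r ∈ Ioc (-1 : ℝ) 1 from ⟨by linarith [hr.1.1], hr.1.2⟩)]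
  · rw [indicator_of_notMem (show r ∉ {r : ℝ | r ∈ Icc (0 : ℝ) 1 ∧ Prec X r t} from hr)]
    by_cases hr1 : r ∈ Ioc (-1 : ℝ) 1
    · rw [indicator_of_mem hr1]
      rcases lt_or_ge r 0 with h0 | h0
      · exact (h.R_eq_zero_of_neg hr1.1 h0 ht.2).symm
      · exact (R_eq_zero_of_not_prec fun hp => hr ⟨⟨h0, hr1.2⟩, hp⟩).symm
    · rw [indicator_of_notMem hr1]

theorem IsPath.dualSup_eq (h : IsPath X) (ht : t ∈ Icc (0 : ℝ) 1) :
    dualSup X t t = height X t := by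
  have h0 : Function.leftLim X 0 = 0 := h.leftLim_of_nonpos (by norm_num) le_rfl
  have hm : ∀ u ∈ Icc 0 t, infOn X (-1) t ≤ Function.leftLim X u := fun u hu =>
    h.infOn_le_leftLim le_rfl (by linarith [hu.1]) hu.2 ht.2
  have hub : ∀ x ∈ dual X t '' Icc 0 t, x ≤ height X t := by
    rintro _ ⟨s, hs, rfl⟩
    unfold dual height
    linarith [hm (t - s) ⟨sub_nonneg.2 hs.2, by linarith [hs.1]⟩]
  have hmem : ∀ u ∈ Icc 0 t, Function.leftLim X t - Function.leftLim X u ≤ dualSup X t t :=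
    fun u hu => le_csSup ⟨_, hub⟩ ⟨t - u, ⟨sub_nonneg.2 hu.2, by linarith [hu.1]⟩, by
      simp [dual]⟩
  refine le_antisymm (csSup_le ((nonempty_Icc.2 ht.1).image _) hub) ?_
  have : Function.leftLim X t - dualSup X t t ≤ infOn X (-1) t := by
    refine le_infOn (by linarith [ht.1]) fun u hu => ?_
    rcases lt_or_ge u 0 with hu0 | hu0
    · linarith [hmem 0 ⟨le_rfl, ht.1⟩, h.zero_before u ⟨hu.1, hu0⟩]
    · linarith [hmem u ⟨hu0, hu.2⟩, h.leftLim_le (t := u) ⟨by linarith, hu.2.trans ht.2⟩]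
  unfold height
  linarith

theorem IsPath.contPart_eq (h : IsPath X) (ht : t ∈ Icc (0 : ℝ) 1) :
    contPart X t = height X t - jumpSum X t := by
  rw [contPart, h.dualSup_eq ht, h.jumpPart_eq ht]

theorem mem_Ioc_of_mem_Icc (ht : t ∈ Icc (0 : ℝ) 1) : t ∈ Ioc (-1 : ℝ) 1 :=
  ⟨by linarith [ht.1], ht.2⟩

theorem IsPath.jumpSum_le (h : IsPath X) (ht : t ∈ Ioc (-1 : ℝ) 1) : jumpSum X t ≤ height X t :=
  (h.summable_R ht).tsum_le_of_sum_le (h.sum_R_le ht)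

theorem IsPath.contPart_nonneg (h : IsPath X) (ht : t ∈ Icc (0 : ℝ) 1) : 0 ≤ contPart X t := by
  rw [h.contPart_eq ht]
  exact sub_nonneg.2 (h.jumpSum_le (mem_Ioc_of_mem_Icc ht))

theorem IsPath.tailSum_sub_le (h : IsPath X) (hs : s ∈ Ioc (-1 : ℝ) 1)
    (ht : t ∈ Ioc (-1 : ℝ) 1) (hst : s < t) (F : Finset (Ioc (-1 : ℝ) 1))
    (hF : (⟨s, hs⟩ : Ioc (-1 : ℝ) 1) ∈ F) : |tailSum X F s - tailSum X F t| ≤ osc X s t := by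
  classical
  exact abs_tsum_sub_sum_le (h.summable_R hs) (h.summable_R ht) F fun A hA =>
    h.sum_abs_R_sub_le hs ht hst A fun hsA => Finset.disjoint_left.1 hA hsA hF

theorem R_le_abs (hst : s < t) : R X s t ≤ |infOn X s t - Function.leftLim X s| := by
  rw [R_eq X hst]
  exact max_le (le_abs_self _) (abs_nonneg _)

theorem IsPath.jumpSum_sub_le (h : IsPath X) (hs : s ∈ Ioc (-1 : ℝ) 1)
    (ht : t ∈ Ioc (-1 : ℝ) 1) (hst : s < t) :
    |jumpSum X s - (jumpSum X t - R X s t)| ≤ osc X s t := by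
  have := h.tailSum_sub_le hs ht hst {⟨s, hs⟩} (Finset.mem_singleton_self _)
  simpa [tailSum, R_eq_zero_of_le X le_rfl] using this

/-- Height and jump sum both gain `R^t_s` up to an error `osc X s t`, so the possibly large term
cancels in their difference. -/
theorem IsPath.contPart_sub_le (h : IsPath X) (hs : s ∈ Icc (0 : ℝ) 1)
    (ht : t ∈ Icc (0 : ℝ) 1) (hst : s < t) :
    |contPart X s - contPart X t| ≤ 2 * osc X s t := by
  have hs' := mem_Ioc_of_mem_Icc hs
  have ht' := mem_Ioc_of_mem_Icc ht
  have h1 := h.jumpSum_sub_le hs' ht' hst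
  have h2 : |height X s - (height X t - R X s t)| ≤ osc X s t := by
    have e := h.infOn_eq_min le_rfl hs'.1.le hst.le ht.2
    have h3 : infOn X (-1) s ≤ Function.leftLim X s := h.infOn_le_leftLim le_rfl hs'.1 le_rfl hs.2
    have h4 : infOn X s t ≤ Function.leftLim X t := h.infOn_le_leftLim hs'.1.le hst le_rfl ht.2
    rw [R_eq X hst, height, height, osc, e, abs_le]
    rcases le_total (infOn X (-1) s) (infOn X s t) with h5 | h5 <;>
    rcases le_total (Function.leftLim X s) (infOn X s t) with h6 | h6 <;>
    simp only [h5, h6, min_eq_left, min_eq_right, max_eq_left, max_eq_right, sub_nonneg,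
      sub_nonpos] <;> constructor <;> linarith
  rw [h.contPart_eq hs, h.contPart_eq ht]
  have := abs_sub (height X s - (height X t - R X s t)) (jumpSum X s - (jumpSum X t - R X s t))
  rw [show height X s - (height X t - R X s t) - (jumpSum X s - (jumpSum X t - R X s t))
    = height X s - jumpSum X s - (height X t - jumpSum X t) by ring] at this
  linarith

theorem IsPath.continuousOn_contPart (h : IsPath X) : ContinuousOn (contPart X) (Icc 0 1) := by
  intro t ht
  refine Metric.tendsto_nhds.2 fun ε hε => ?_
  -- The criterion is stated on `(-1,1]`, but the increment bound for `C` holds on `[0,1]` only;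
  -- hence the value `0` outside.
  have key := h.eventually_le_of_osc (mem_Ioc_of_mem_Icc ht)
    (D := fun s => if s ∈ Icc (0 : ℝ) 1 then |contPart X s - contPart X t| else 0)
    (by simp) (fun s hs hst => ?_) (fun s hs hst => ?_) (half_pos hε)
  · filter_upwards [nhdsWithin_mono _ (fun s hs => mem_Ioc_of_mem_Icc hs) key,
      self_mem_nhdsWithin] with s hs hs1
    rw [if_pos hs1] at hs
    rw [Real.dist_eq]
    linarith
  · have := h.osc_nonneg hs.1.le hst ht.2
    split_ifs with hs0
    · linarith [h.contPart_sub_le hs0 ht hst, abs_nonneg (infOn X s t - Function.leftLim X s)]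
    · positivity
  · have := h.osc_nonneg (by linarith [ht.1]) hst hs.2
    split_ifs with hs0
    · rw [abs_sub_comm]
      linarith [h.contPart_sub_le ht hs0 hst, abs_nonneg (X t - infOn X t s)]
    · positivity

/-- A Dini-type argument: tails decrease with `F`, are small at each fixed `t` for a suitable `F`,
and stay small near `t`. Compactness of `[0,1]` then yields one finite set. -/
theorem IsPath.exists_tailSum_le (h : IsPath X) {ε : ℝ} (hε : 0 < ε) :
    ∃ F : Finset (Ioc (-1 : ℝ) 1), ∀ t ∈ Ioc (-1 : ℝ) 1, tailSum X F t ≤ ε := by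
  classical
  have hmono : ∀ F G : Finset (Ioc (-1 : ℝ) 1), F ⊆ G → ∀ t, tailSum X G t ≤ tailSum X F t :=
    fun F G hFG t => sub_le_sub_left
      (Finset.sum_le_sum_of_subset_of_nonneg hFG fun r _ _ => R_nonneg X r t) _
  suffices ∃ F : Finset (Ioc (-1 : ℝ) 1), ∀ t ∈ Icc (0 : ℝ) 1, tailSum X F t ≤ ε by
    obtain ⟨F, hF⟩ := this
    refine ⟨F, fun t ht => ?_⟩
    have : tailSum X F t = tailSum X F (max t 0) := by
      simp only [tailSum, jumpSum]
      congr 1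
      · exact tsum_congr fun r => (h.R_max_zero r.2.1 ht.2).symm
      · exact Finset.sum_congr rfl fun r _ => (h.R_max_zero r.2.1 ht.2).symm
    rw [this]
    exact hF _ ⟨le_max_right _ _, max_le ht.2 zero_le_one⟩
  refine isCompact_Icc.induction_on
    (p := fun S => ∃ F : Finset (Ioc (-1 : ℝ) 1), ∀ t ∈ S, tailSum X F t ≤ ε) ⟨∅, by simp⟩
    (fun S T hST ⟨F, hF⟩ => ⟨F, fun t ht => hF t (hST ht)⟩)
    (fun S T ⟨F, hF⟩ ⟨G, hG⟩ => ⟨F ∪ G, fun t ht => ht.elim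
      (fun ht => (hmono _ _ Finset.subset_union_left t).trans (hF t ht))
      (fun ht => (hmono _ _ Finset.subset_union_right t).trans (hG t ht))⟩) fun t ht0 => ?_
  have ht := mem_Ioc_of_mem_Icc ht0
  obtain ⟨F, hF⟩ := ((tendsto_order.1 (h.summable_R ht).hasSum).1
    (jumpSum X t - ε / 2) (by unfold jumpSum; linarith)).exists
  -- Including `t` removes from the tail the term `R^s_t`, which is not small for `s` just after
  -- `t`.
  obtain ⟨G, hFG, hG⟩ : ∃ G, F ⊆ G ∧ (⟨t, ht⟩ : Ioc (-1 : ℝ) 1) ∈ G :=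
    ⟨insert ⟨t, ht⟩ F, Finset.subset_insert _ _, Finset.mem_insert_self _ _⟩
  have hGt : tailSum X G t ≤ ε / 2 := (hmono F G hFG t).trans (by unfold tailSum; linarith)
  have key := h.eventually_le_of_osc ht (D := fun s => tailSum X G s - tailSum X G t)
    (by simp) (fun s hs hst => ?_) (fun s hs hst => ?_) (half_pos hε)
  · refine ⟨_, nhdsWithin_mono _ (fun s hs => mem_Ioc_of_mem_Icc hs) key, G, fun s hs => ?_⟩
    have hs : tailSum X G s - tailSum X G t ≤ ε / 2 := hs
    linarith
  -- On the left `s` need not lie in `G`. Adding it leaves the tail at `s` unchanged, as `R^s_s =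
  -- 0`, and can only lower the tail at `t`.
  · have h1 := h.tailSum_sub_le hs ht hst (insert ⟨s, hs⟩ G) (Finset.mem_insert_self _ _)
    have h2 : tailSum X G s = tailSum X (insert ⟨s, hs⟩ G) s := by
      unfold tailSum
      rw [Finset.sum_insert_zero (f := fun r : Ioc (-1 : ℝ) 1 => R X r s)
        (R_eq_zero_of_le X le_rfl)]
    have h3 := hmono G (insert ⟨s, hs⟩ G) (Finset.subset_insert _ _) t
    have := h.osc_nonneg hs.1.le hst ht.2
    linarith [(abs_le.1 h1).2, abs_nonneg (infOn X s t - Function.leftLim X s)]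
  · have h1 := h.tailSum_sub_le ht hs hst G hG
    have := h.osc_nonneg ht.1.le hst hs.2
    linarith [(abs_le.1 h1).1, abs_nonneg (X t - infOn X t s)]

end Path

/-! ### The looptree distance as a sum over all cycles -/

theorem tsum_subtype_eq_tsum_indicator {ι : Type*} {S T : Set ι} (hST : S ⊆ T) (f : ι → ℝ) :
    ∑' r : S, f r = ∑' r : T, S.indicator f r := by
  rw [tsum_subtype S f, tsum_subtype T (S.indicator f), indicator_indicator,
    inter_eq_self_of_subset_right hST]

section Path

variable {X : ℝ → ℝ} {r s t u c : ℝ}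

/-- The sum over all cycles of the distances between the projections of `s` and `t`. -/
noncomputable def loopSum (X : ℝ → ℝ) (s t : ℝ) : ℝ :=
  ∑' r : Ioc (-1 : ℝ) 1, cycleDist (jump X r) (R X r s) (R X r t)

theorem IsPath.R_mem (h : IsPath X) (hr : r ∈ Ioc (-1 : ℝ) 1) (ht : t ≤ 1) :
    R X r t ∈ Icc 0 (jump X r) :=
  ⟨R_nonneg X r t, h.R_le_jump hr ht⟩

theorem cycleDist_R_le (X : ℝ → ℝ) (r s t : ℝ) :
    cycleDist (jump X r) (R X r s) (R X r t) ≤ R X r s + R X r t :=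
  (cycleDist_le _ _ _).trans (abs_sub_le_iff.2
    ⟨by linarith [R_nonneg X r t], by linarith [R_nonneg X r s]⟩)

theorem IsPath.summable_cycleDist (h : IsPath X) (hs : s ∈ Ioc (-1 : ℝ) 1)
    (ht : t ∈ Ioc (-1 : ℝ) 1) :
    Summable fun r : Ioc (-1 : ℝ) 1 => cycleDist (jump X r) (R X r s) (R X r t) :=
  .of_nonneg_of_le (fun r => cycleDist_nonneg (h.R_mem r.2 hs.2) (h.R_mem r.2 ht.2))
    (fun r => cycleDist_R_le X r s t) ((h.summable_R hs).add (h.summable_R ht))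

/-- Since `inf_{[u,s]} X ≥ X_{u-} ≥ inf_{[r,u]} X`, the path after `u` does not lower the infimum
from `r`. -/
theorem IsPath.R_eq_of_precEq (h : IsPath X) (hr : -1 < r) (hru : r < u) (hus : PrecEq X u s)
    (hs : s ≤ 1) : R X r s = R X r u := by
  rcases hus with ⟨hus, hle⟩ | rfl
  · rw [R_eq X (hru.trans hus), R_eq X hru, h.infOn_eq_min hr.le hru.le hus.le hs, min_eq_left]
    exact (h.infOn_le_leftLim hr.le hru le_rfl (hus.le.trans hs)).trans hle
  · rfl

theorem lastCommon_mem (X : ℝ → ℝ) (s t : ℝ) : lastCommon X s t ∈ Icc (0 : ℝ) 1 := by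
  have hsub : ∀ r ∈ {r : ℝ | r ∈ Icc (0 : ℝ) 1 ∧ PrecEq X r s ∧ PrecEq X r t}, r ∈ Icc (0 : ℝ) 1 :=
    fun r hr => hr.1
  exact ⟨Real.sSup_nonneg fun r hr => (hsub r hr).1, Real.sSup_le (fun r hr => (hsub r hr).2)
    zero_le_one⟩

theorem le_lastCommon (hr : r ∈ Icc (0 : ℝ) 1) (hrs : PrecEq X r s) (hrt : PrecEq X r t) :
    r ≤ lastCommon X s t :=
  le_csSup ⟨1, fun _ hu => hu.1.2⟩ ⟨hr, hrs, hrt⟩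

theorem IsPath.R_eq_of_lt_lastCommon (h : IsPath X) (hr : -1 < r) (hra : r < lastCommon X s t)
    (hs : s ≤ 1) (ht : t ≤ 1) : R X r s = R X r t := by
  rcases lt_or_ge r 0 with h0 | h0
  · rw [h.R_eq_zero_of_neg hr h0 hs, h.R_eq_zero_of_neg hr h0 ht]
  -- Without a common ancestor the supremum is `0`, and only the negative `r` already treated lie
  -- below it. Otherwise a common ancestor beyond `r` suffices; the supremum need not be attained.
  have hne : {r : ℝ | r ∈ Icc (0 : ℝ) 1 ∧ PrecEq X r s ∧ PrecEq X r t}.Nonempty := by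
    by_contra hne
    rw [lastCommon, not_nonempty_iff_eq_empty.1 hne, Real.sSup_empty] at hra
    linarith
  obtain ⟨u, hu, hru⟩ := exists_lt_of_lt_csSup hne hra
  rw [h.R_eq_of_precEq hr hru hu.2.1 hs, h.R_eq_of_precEq hr hru hu.2.2 ht]

theorem branchSum_eq {p : ℝ} (hp : 0 ≤ p) (hs : s ≤ 1) :
    branchSum X p s = ∑' r : Ioc (-1 : ℝ) 1, {r : ℝ | p < r ∧ Prec X r s}.indicator
      (fun r => cycleDist (jump X r) 0 (R X r s)) r :=
  tsum_subtype_eq_tsum_indicator (S := {r : ℝ | p < r ∧ Prec X r s}) (T := Ioc (-1) 1)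
    (fun r hr => ⟨by linarith [hr.1], hr.2.1.le.trans hs⟩)
    (fun r => cycleDist (jump X r) 0 (R X r s))

theorem IsPath.summable_branch (h : IsPath X) (hs : s ∈ Ioc (-1 : ℝ) 1) (p : ℝ) :
    Summable fun r : Ioc (-1 : ℝ) 1 => {r : ℝ | p < r ∧ Prec X r s}.indicator
      (fun r => cycleDist (jump X r) 0 (R X r s)) r := by
  have h0 : ∀ r : Ioc (-1 : ℝ) 1, 0 ≤ cycleDist (jump X r) 0 (R X r s) := fun r =>
    cycleDist_nonneg ⟨le_rfl, h.jump_nonneg r.2⟩ (h.R_mem r.2 hs.2)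
  refine .of_nonneg_of_le (fun r => ?_) (fun r => ?_) (h.summable_R hs)
  · exact indicator_apply_nonneg fun _ => h0 r
  · refine indicator_apply_le' (fun _ => ?_) fun _ => R_nonneg X r s
    refine (cycleDist_le _ _ _).trans_eq ?_
    rw [zero_sub, abs_neg, abs_of_nonneg (R_nonneg X r s)]

/-- Below `s ∧ t` the two positions on each cycle coincide and contribute zero. Above it a cycle is
an ancestor of at most one of `s`, `t`, so the other position is `0`. -/
theorem IsPath.distLoopZero_eq (h : IsPath X) (hs : s ∈ Icc (0 : ℝ) 1) (ht : t ∈ Icc (0 : ℝ) 1) :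
    distLoopZero X s t = loopSum X s t := by
  have hs' := mem_Ioc_of_mem_Icc hs
  have ht' := mem_Ioc_of_mem_Icc ht
  have ha := lastCommon_mem X s t
  unfold distLoopZero
  rw [branchSum_eq ha.1 hs.2, branchSum_eq ha.1 ht.2]
  have hsingle : HasSum (fun r : Ioc (-1 : ℝ) 1 => ({lastCommon X s t} : Set ℝ).indicator
      (fun r => cycleDist (jump X r) (R X r s) (R X r t)) r)
      (cycleDist (jump X (lastCommon X s t)) (R X (lastCommon X s t) s)
        (R X (lastCommon X s t) t)) := by
    have := hasSum_single (f := fun r : Ioc (-1 : ℝ) 1 => ({lastCommon X s t} : Set ℝ).indicator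
      (fun r => cycleDist (jump X r) (R X r s) (R X r t)) r)
      ⟨lastCommon X s t, mem_Ioc_of_mem_Icc ha⟩ fun r hr =>
        indicator_of_notMem (s := {lastCommon X s t}) (fun hr' => hr (Subtype.ext hr')) _
    simpa using this
  refine (((hsingle.add (h.summable_branch hs' _).hasSum).add
    (h.summable_branch ht' _).hasSum).tsum_eq.symm.trans (tsum_congr fun r => ?_))
  rcases lt_trichotomy (r : ℝ) (lastCommon X s t) with hr | hr | hr
  · rw [indicator_of_notMem (s := {lastCommon X s t}) (fun hr' => hr.ne hr'), indicator_of_notMem (fun hr' => hr.not_gt hr'.1),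
      indicator_of_notMem (fun hr' => hr.not_gt hr'.1),
      h.R_eq_of_lt_lastCommon r.2.1 hr hs.2 ht.2, cycleDist_self (h.jump_nonneg r.2)]
    simp
  · rw [indicator_of_mem (show (r : ℝ) ∈ {lastCommon X s t} from hr),
      indicator_of_notMem (fun hr' => hr.not_gt hr'.1),
      indicator_of_notMem (fun hr' => hr.not_gt hr'.1)]
    simp
  · have hr01 : (r : ℝ) ∈ Icc (0 : ℝ) 1 := ⟨ha.1.trans hr.le, r.2.2⟩
    rw [indicator_of_notMem (s := {lastCommon X s t}) (fun hr' => hr.ne' hr'), zero_add]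
    by_cases h1 : Prec X r s
    · have h2 : ¬ Prec X r t := fun h2 => hr.not_ge (le_lastCommon hr01 (Or.inl h1) (Or.inl h2))
      rw [indicator_of_mem (show (r : ℝ) ∈ {r : ℝ | lastCommon X s t < r ∧ Prec X r s} from ⟨hr, h1⟩),
        indicator_of_notMem (fun hr' => h2 hr'.2), R_eq_zero_of_not_prec h2, add_zero,
        cycleDist_comm]
    · rw [indicator_of_notMem (fun hr' => h1 hr'.2), R_eq_zero_of_not_prec h1, zero_add]
      by_cases h2 : Prec X r t
      · rw [indicator_of_mem
          (show (r : ℝ) ∈ {r : ℝ | lastCommon X s t < r ∧ Prec X r t} from ⟨hr, h2⟩)]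
      · rw [indicator_of_notMem (fun hr' => h2 hr'.2), R_eq_zero_of_not_prec h2,
          cycleDist_self (h.jump_nonneg r.2)]

theorem IsPath.distLoop_eq (h : IsPath X) (hs : s ∈ Icc (0 : ℝ) 1) (ht : t ∈ Icc (0 : ℝ) 1) :
    distLoop X s t = loopSum X s t + distTree (contPart X) s t := by
  rw [distLoop, distLoopParam, one_mul, h.distLoopZero_eq hs ht]

/-! ### The tree distance -/

theorem distTree_self (g : ℝ → ℝ) (s : ℝ) : distTree g s s = 0 := by
  simp [distTree, two_mul]

theorem distTree_comm (g : ℝ → ℝ) (s t : ℝ) : distTree g s t = distTree g t s := by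
  simp [distTree, uIcc_comm, add_comm]

theorem distTree_triangle {g : ℝ → ℝ} {I : Set ℝ} [I.OrdConnected] (hg : ∀ x ∈ I, 0 ≤ g x)
    (hs : s ∈ I) (ht : t ∈ I) (hu : u ∈ I) :
    distTree g s u ≤ distTree g s t + distTree g t u := by
  have hsub : ∀ {a b}, a ∈ I → b ∈ I → uIcc a b ⊆ I := fun ha hb =>
    Set.OrdConnected.uIcc_subset inferInstance ha hb
  have hle : ∀ {a b c}, a ∈ I → b ∈ I → c ∈ uIcc a b → sInf (g '' uIcc a b) ≤ g c :=
    fun ha hb hc => csInf_le ⟨0, by rintro _ ⟨x, hx, rfl⟩; exact hg x (hsub ha hb hx)⟩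
      (mem_image_of_mem _ hc)
  have key : min (sInf (g '' uIcc s t)) (sInf (g '' uIcc t u)) ≤ sInf (g '' uIcc s u) := by
    refine le_csInf (nonempty_uIcc.image _) ?_
    rintro _ ⟨x, hx, rfl⟩
    rcases uIcc_subset_uIcc_union_uIcc (b := t) hx with hx | hx
    · exact (min_le_left _ _).trans (hle hs ht hx)
    · exact (min_le_right _ _).trans (hle ht hu hx)
  unfold distTree
  have h1 := hle hs ht right_mem_uIcc
  have h2 := hle ht hu left_mem_uIcc
  rcases min_le_iff.1 key with h3 | h3 <;> linarith

theorem distTree_le {g : ℝ → ℝ} (hg : ∀ x ∈ uIcc s t, c ≤ g x) :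
    distTree g s t ≤ g s + g t - 2 * c := by
  have : c ≤ sInf (g '' uIcc s t) :=
    le_csInf (nonempty_uIcc.image _) (by rintro _ ⟨x, hx, rfl⟩; exact hg x hx)
  unfold distTree
  linarith

theorem distTree_nonneg {g : ℝ → ℝ} (hg : ∀ x ∈ uIcc s t, 0 ≤ g x) : 0 ≤ distTree g s t := by
  have hle : ∀ {x}, x ∈ uIcc s t → sInf (g '' uIcc s t) ≤ g x := fun hx =>
    csInf_le ⟨0, by rintro _ ⟨x, hx, rfl⟩; exact hg x hx⟩ (mem_image_of_mem _ hx)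
  unfold distTree
  linarith [hle left_mem_uIcc, hle right_mem_uIcc]

theorem eventually_distTree_le {g : ℝ → ℝ} {I : Set ℝ} [I.OrdConnected] (hg : ContinuousOn g I)
    (ht : t ∈ I) {ε : ℝ} (hε : 0 < ε) : ∀ᶠ s in 𝓝[I] t, distTree g s t ≤ ε := by
  obtain ⟨δ, hδ, hδg⟩ := Metric.continuousOn_iff.1 hg t ht (ε / 4) (by positivity)
  filter_upwards [self_mem_nhdsWithin, mem_nhdsWithin_of_mem_nhds (Metric.ball_mem_nhds t hδ)]
    with s hs hst
  have hcl : ∀ x ∈ uIcc s t, |g x - g t| < ε / 4 := fun x hx =>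
    hδg x (Set.OrdConnected.uIcc_subset inferInstance hs ht hx)
      ((convex_ball t δ).ordConnected.uIcc_subset hst (Metric.mem_ball_self hδ) hx)
  have := distTree_le (g := g) (c := g t - ε / 4) fun x hx => by linarith [(abs_lt.1 (hcl x hx)).1]
  linarith [(abs_lt.1 (hcl s left_mem_uIcc)).2]

/-! ### The looptree distance is a continuous pseudo-distance -/

theorem IsPath.isPseudoDist (h : IsPath X) : IsPseudoDist (distUnit X) where
  self s := by
    rw [distUnit, h.distLoop_eq s.2 s.2, distTree_self, add_zero, loopSum]
    exact (tsum_congr fun r => cycleDist_self (h.jump_nonneg r.2) _).trans tsum_zero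
  symm s t := by
    rw [distUnit, distUnit, h.distLoop_eq s.2 t.2, h.distLoop_eq t.2 s.2, distTree_comm, loopSum,
      loopSum]
    congr 1
    exact tsum_congr fun r => cycleDist_comm _ _ _
  triangle s t u := by
    have hs := mem_Ioc_of_mem_Icc s.2
    have ht := mem_Ioc_of_mem_Icc t.2
    have hu := mem_Ioc_of_mem_Icc u.2
    rw [distUnit, distUnit, distUnit, h.distLoop_eq s.2 t.2, h.distLoop_eq s.2 u.2,
      h.distLoop_eq t.2 u.2]
    have h1 := distTree_triangle (fun x hx => h.contPart_nonneg hx) s.2 t.2 u.2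
    have h2 : loopSum X s u ≤ loopSum X s t + loopSum X t u := by
      unfold loopSum
      rw [← (h.summable_cycleDist hs ht).tsum_add (h.summable_cycleDist ht hu)]
      exact (h.summable_cycleDist hs hu).tsum_le_tsum (fun r => cycleDist_triangle
        (h.R_mem r.2 hs.2) (h.R_mem r.2 ht.2) (h.R_mem r.2 hu.2))
        ((h.summable_cycleDist hs ht).add (h.summable_cycleDist ht hu))
    linarith

theorem IsPath.loopSum_le (h : IsPath X) (hs : s ∈ Ioc (-1 : ℝ) 1)
    (ht : t ∈ Ioc (-1 : ℝ) 1) (hst : s < t) :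
    loopSum X s t ≤ osc X s t + cycleDist (jump X s) 0 (R X s t) := by
  classical
  have := abs_tsum_sub_sum_le (h.summable_cycleDist hs ht) summable_zero {⟨s, hs⟩}
    (K := osc X s t) fun A hA => by
      refine le_trans (Finset.sum_le_sum fun r _ => ?_)
        (h.sum_abs_R_sub_le hs ht hst A (Finset.disjoint_singleton_right.1 hA))
      rw [sub_zero, abs_of_nonneg (cycleDist_nonneg (h.R_mem r.2 hs.2) (h.R_mem r.2 ht.2))]
      exact cycleDist_le _ _ _
  simp only [Finset.sum_singleton, tsum_zero, sub_zero, R_eq_zero_of_le X le_rfl] at this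
  unfold loopSum
  linarith [(abs_le.1 this).2]

theorem loopSum_comm (X : ℝ → ℝ) (s t : ℝ) : loopSum X s t = loopSum X t s :=
  tsum_congr fun _ => cycleDist_comm _ _ _

theorem IsPath.eventually_loopSum_le (h : IsPath X) (ht : t ∈ Ioc (-1 : ℝ) 1) {ε : ℝ}
    (hε : 0 < ε) : ∀ᶠ s in 𝓝[Ioc (-1 : ℝ) 1] t, loopSum X s t ≤ ε := by
  refine h.eventually_le_of_osc ht (D := fun s => loopSum X s t) (le_of_eq ?_)
    (fun s hs hst => ?_) (fun s hs hst => ?_) hε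
  · exact (tsum_congr fun r => cycleDist_self (h.jump_nonneg r.2) _).trans tsum_zero
  · have h1 := h.loopSum_le hs ht hst
    have h2 := cycleDist_le (jump X s) 0 (R X s t)
    rw [zero_sub, abs_neg, abs_of_nonneg (R_nonneg X s t)] at h2
    linarith [h.osc_nonneg hs.1.le hst ht.2, R_le_abs (X := X) hst]
  -- Just after a jump the position on its cycle is near `ΔX_t`, hence near `0` by going round the
  -- other way: the second term of the minimum is used.
  · have h1 := h.loopSum_le ht hs hst
    have h2 : cycleDist (jump X t) 0 (R X t s) ≤ X t - infOn X t s := by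
      refine (min_le_right _ _).trans ?_
      rw [zero_sub, abs_neg, abs_of_nonneg (R_nonneg X t s), R_eq X hst, jump]
      linarith [le_max_left (infOn X t s - Function.leftLim X t) 0]
    rw [loopSum_comm]
    linarith [h.osc_nonneg ht.1.le hst hs.2, le_abs_self (X t - infOn X t s)]

theorem IsPath.tendsto_distUnit (h : IsPath X) (t : unitInterval) :
    Tendsto (fun s => distUnit X s t) (𝓝 t) (𝓝 0) := by
  have hcoe : Tendsto (Subtype.val : unitInterval → ℝ) (𝓝 t) (𝓝[Icc 0 1] (t : ℝ)) :=
    tendsto_nhdsWithin_iff.2 ⟨continuous_subtype_val.tendsto t, Eventually.of_forall fun s => s.2⟩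
  have hnn : ∀ s, 0 ≤ distUnit X s t := fun s => by
    have h1 := h.isPseudoDist.triangle s t s
    rw [h.isPseudoDist.self, h.isPseudoDist.symm t s] at h1
    linarith
  refine Metric.tendsto_nhds.2 fun ε hε => ?_
  filter_upwards [hcoe.eventually (eventually_distTree_le h.continuousOn_contPart t.2
      (show 0 < ε / 3 by positivity)), hcoe.eventually ((h.eventually_loopSum_le
      (mem_Ioc_of_mem_Icc t.2) (show 0 < ε / 3 by positivity)).filter_mono
      (nhdsWithin_mono _ fun s hs => mem_Ioc_of_mem_Icc hs))] with s hs1 hs2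
  rw [Real.dist_eq, sub_zero, abs_of_nonneg (hnn s), distUnit, h.distLoop_eq s.2 t.2]
  linarith

theorem IsPath.continuous_distUnit (h : IsPath X) :
    Continuous (Function.uncurry (distUnit X)) := by
  refine continuous_iff_continuousAt.2 fun ⟨s, t⟩ => ?_
  refine tendsto_iff_dist_tendsto_zero.2 ?_
  have hd := h.isPseudoDist
  have h1 : Tendsto (fun p : unitInterval × unitInterval => distUnit X p.1 s + distUnit X p.2 t)
      (𝓝 (s, t)) (𝓝 (0 + 0)) :=
    ((h.tendsto_distUnit s).comp (continuous_fst.tendsto (s, t))).add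
      ((h.tendsto_distUnit t).comp (continuous_snd.tendsto (s, t)))
  rw [add_zero] at h1
  refine squeeze_zero (fun _ => dist_nonneg) (fun p => ?_) h1
  simp only [Function.uncurry, Real.dist_eq]
  rw [abs_sub_le_iff]
  constructor
  · linarith [hd.triangle p.1 s p.2, hd.triangle s t p.2, hd.symm t p.2]
  · linarith [hd.triangle s p.1 t, hd.triangle p.1 p.2 t, hd.symm s p.1]

/-! ### The looptree as a compact probability space. -/

theorem IsPath.continuous_proj (h : IsPath X) : Continuous (proj X) := by
  refine continuous_iff_continuousAt.2 fun t => tendsto_iff_dist_tendsto_zero.2 ?_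
  simp only [dist_proj X h.isPseudoDist]
  exact h.tendsto_distUnit t

theorem proj_surjective (X : ℝ → ℝ) : Function.Surjective (proj X) :=
  SeparationQuotient.surjective_mk (X := Time X)

theorem IsPath.compactSpace (h : IsPath X) : CompactSpace (Loop X) :=
  ⟨by rw [← (proj_surjective X).range_eq]; exact isCompact_range h.continuous_proj⟩

theorem IsPath.isProbabilityMeasure (h : IsPath X) : IsProbabilityMeasure (loopMeasure X) :=
  Measure.isProbabilityMeasure_map h.continuous_proj.measurable.aemeasurable

/-! ### Gromov–Hausdorff–Prokhorov distance of close looptrees -/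

/-- Pairing the two projections of the same time gives both the correspondence and, with Lebesgue
measure, a coupling of full mass on it. -/
theorem ghpDist_le {Y : ℝ → ℝ} (hX : IsPath X) (hY : IsPath Y) {ε : ℝ} (hε : 0 < ε)
    (hXY : ∀ s ∈ Icc (0 : ℝ) 1, ∀ t ∈ Icc (0 : ℝ) 1,
      |distLoop X s t - distLoop Y s t| ≤ 2 * ε) :
    ghpDist (loopMeasure X) (loopMeasure Y) ≤ ENNReal.ofReal ε := by
  refine iInf₂_le ε ⟨hε, Measure.map (fun s => (proj X s, proj Y s)) volume,
    range fun s => (proj X s, proj Y s), ?_, ?_, ?_, fun x => ?_, fun y => ?_, ?_, ?_⟩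
  · rw [Measure.map_map measurable_fst
      (hX.continuous_proj.measurable.prodMk hY.continuous_proj.measurable)]
    rfl
  · rw [Measure.map_map measurable_snd
      (hX.continuous_proj.measurable.prodMk hY.continuous_proj.measurable)]
    rfl
  · exact isCompact_range (hX.continuous_proj.prodMk hY.continuous_proj)
  · obtain ⟨s, rfl⟩ := proj_surjective X x
    exact ⟨_, s, rfl⟩
  · obtain ⟨s, rfl⟩ := proj_surjective Y y
    exact ⟨_, s, rfl⟩
  · refine le_trans ?_ (Measure.le_map_apply
      (hX.continuous_proj.measurable.prodMk hY.continuous_proj.measurable).aemeasurable _)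
    rw [← image_univ, preimage_image_univ, measure_univ]
    exact ENNReal.ofReal_le_one.2 (by linarith)
  · rintro _ ⟨s, rfl⟩ _ ⟨t, rfl⟩
    rw [dist_proj X hX.isPseudoDist, dist_proj Y hY.isPseudoDist]
    exact hXY s s.2 t t.2

end Path

/-! ### Comparison of two paths up to a time change -/

/-- The restriction of a time change to `(-1,1]`. -/
def shift (e : Icc (-1 : ℝ) 1 ≃o Icc (-1 : ℝ) 1) : Ioc (-1 : ℝ) 1 ↪ Ioc (-1 : ℝ) 1 where
  toFun r := ⟨e ⟨r, Ioc_subset_Icc_self r.2⟩, by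
    have h : e ⟨-1, by simp⟩ < e ⟨r, Ioc_subset_Icc_self r.2⟩ := e.strictMono r.2.1
    exact lt_of_le_of_lt (e ⟨-1, by simp⟩).2.1 h, (e _).2.2⟩
  inj' r s hrs := by
    have h : e ⟨r, Ioc_subset_Icc_self r.2⟩ = e ⟨s, Ioc_subset_Icc_self s.2⟩ :=
      Subtype.ext (congrArg (fun x : Ioc (-1 : ℝ) 1 => (x : ℝ)) hrs)
    exact Subtype.ext (Subtype.mk.inj (e.injective h))

theorem coe_shift (e : Icc (-1 : ℝ) 1 ≃o Icc (-1 : ℝ) 1) (r : Ioc (-1 : ℝ) 1) :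
    (shift e r : ℝ) = e ⟨r, Ioc_subset_Icc_self r.2⟩ := rfl

theorem shift_lt_shift (e : Icc (-1 : ℝ) 1 ≃o Icc (-1 : ℝ) 1) {r s : Ioc (-1 : ℝ) 1} :
    shift e r < shift e s ↔ r < s :=
  e.lt_iff_lt (x := ⟨r, Ioc_subset_Icc_self r.2⟩) (y := ⟨s, Ioc_subset_Icc_self s.2⟩)

section Comparison

variable {X Y : ℝ → ℝ} {e : Icc (-1 : ℝ) 1 ≃o Icc (-1 : ℝ) 1} {η : ℝ}

theorem abs_infOn_sub_le (hX : IsPath X) (hY : IsPath Y)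
    (he : ∀ t : Icc (-1 : ℝ) 1, |Y (e t) - X t| ≤ η) {r t : Icc (-1 : ℝ) 1} (hrt : r ≤ t) :
    |infOn Y (e r) (e t) - infOn X r t| ≤ η := by
  rw [abs_sub_le_iff]
  constructor
  · have : infOn Y (e r) (e t) - η ≤ infOn X r t := le_infOn hrt fun u hu => by
      have hu1 : u ∈ Icc (-1 : ℝ) 1 := ⟨r.2.1.trans hu.1, hu.2.trans t.2.2⟩
      have h1 := hY.infOn_le (e r).2.1 (e t).2.2 (u := e ⟨u, hu1⟩)
        ⟨e.monotone (show r ≤ ⟨u, hu1⟩ from hu.1), e.monotone (show ⟨u, hu1⟩ ≤ t from hu.2)⟩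
      linarith [(abs_le.1 (he ⟨u, hu1⟩)).2]
    linarith
  · have : infOn X r t - η ≤ infOn Y (e r) (e t) := le_infOn (e.monotone hrt) fun u hu => by
      have hu1 : u ∈ Icc (-1 : ℝ) 1 := ⟨(e r).2.1.trans hu.1, hu.2.trans (e t).2.2⟩
      obtain ⟨v, hv⟩ := e.surjective ⟨u, hu1⟩
      have hv' : (e v : ℝ) = u := congrArg Subtype.val hv
      have hrv : r ≤ v := e.le_iff_le.1 (show (e r : ℝ) ≤ e v by rw [hv']; exact hu.1)
      have hvt : v ≤ t := e.le_iff_le.1 (show (e v : ℝ) ≤ e t by rw [hv']; exact hu.2)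
      have h1 := hX.infOn_le r.2.1 t.2.2 (u := v) ⟨hrv, hvt⟩
      rw [← hv']
      linarith [(abs_le.1 (he v)).1]
    linarith

theorem abs_leftLim_sub_le (hX : IsPath X) (hY : IsPath Y)
    (he : ∀ t : Icc (-1 : ℝ) 1, |Y (e t) - X t| ≤ η) (r : Ioc (-1 : ℝ) 1) :
    |Function.leftLim Y (shift e r) - Function.leftLim X r| ≤ η := by
  set r' : Icc (-1 : ℝ) 1 := ⟨r, Ioc_subset_Icc_self r.2⟩ with hr'
  have hcoe : ∀ x : Icc (-1 : ℝ) 1,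
      Tendsto (Subtype.val : Icc (-1 : ℝ) 1 → ℝ) (𝓝[<] x) (𝓝[<] (x : ℝ)) := fun x =>
    tendsto_nhdsWithin_iff.2 ⟨(continuous_subtype_val.tendsto x).mono_left nhdsWithin_le_nhds,
      eventually_mem_nhdsWithin.mono fun y hy => hy⟩
  have he' : Tendsto e (𝓝[<] r') (𝓝[<] (e r')) :=
    tendsto_nhdsWithin_iff.2 ⟨(e.continuous.tendsto r').mono_left nhdsWithin_le_nhds,
      eventually_mem_nhdsWithin.mono fun y hy => e.strictMono hy⟩
  have hne : (𝓝[<] r').NeBot :=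
    nhdsLT_neBot_of_exists_lt ⟨⟨-1, by simp⟩, show (-1 : ℝ) < r from r.2.1⟩
  have h1 : Tendsto (fun u => |Y (e u) - X u|) (𝓝[<] r')
      (𝓝 |Function.leftLim Y (shift e r) - Function.leftLim X r|) :=
    (((hY.tendsto_leftLim (shift e r).2).comp ((hcoe (e r')).comp he')).sub
      ((hX.tendsto_leftLim r.2).comp (hcoe r'))).abs
  exact le_of_tendsto h1 (Eventually.of_forall he)

theorem abs_jump_sub_le (hX : IsPath X) (hY : IsPath Y)
    (he : ∀ t : Icc (-1 : ℝ) 1, |Y (e t) - X t| ≤ η) (r : Ioc (-1 : ℝ) 1) :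
    |jump Y (shift e r) - jump X r| ≤ 2 * η := by
  have h1 := abs_le.1 (abs_leftLim_sub_le hX hY he r)
  have h2 := abs_le.1 (he ⟨r, Ioc_subset_Icc_self r.2⟩)
  rw [← coe_shift] at h2
  unfold jump
  exact abs_le.2 ⟨by linarith, by linarith⟩

theorem abs_R_sub_le (hX : IsPath X) (hY : IsPath Y)
    (he : ∀ t : Icc (-1 : ℝ) 1, |Y (e t) - X t| ≤ η) (r t : Ioc (-1 : ℝ) 1) :
    |R Y (shift e r) (shift e t) - R X r t| ≤ 2 * η := by
  rcases lt_or_ge r t with hrt | hrt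
  · rw [R_eq X hrt, R_eq Y ((shift_lt_shift e).2 hrt)]
    refine (abs_max_sub_max_le_abs _ _ _).trans ?_
    have h1 := abs_le.1 (abs_leftLim_sub_le hX hY he r)
    have h2 := abs_le.1 (abs_infOn_sub_le hX hY he (r := ⟨r, Ioc_subset_Icc_self r.2⟩)
      (t := ⟨t, Ioc_subset_Icc_self t.2⟩) hrt.le)
    rw [← coe_shift, ← coe_shift] at h2
    exact abs_le.2 ⟨by linarith, by linarith⟩
  · rw [R_eq_zero_of_le X hrt,
      R_eq_zero_of_le Y (not_lt.1 fun hlt => hrt.not_gt ((shift_lt_shift e).1 hlt)), sub_self,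
      abs_zero]
    linarith [(abs_nonneg _).trans (he ⟨r, Ioc_subset_Icc_self r.2⟩)]

theorem abs_height_sub_le (hX : IsPath X) (hY : IsPath Y)
    (he : ∀ t : Icc (-1 : ℝ) 1, |Y (e t) - X t| ≤ η) (t : Ioc (-1 : ℝ) 1) :
    |height Y (shift e t) - height X t| ≤ 2 * η := by
  have hbot : ((e ⟨-1, by simp⟩ : Icc (-1 : ℝ) 1) : ℝ) = -1 := by
    obtain ⟨v, hv⟩ := e.surjective ⟨-1, by simp⟩
    refine le_antisymm ?_ (e _).2.1
    have : e ⟨-1, by simp⟩ ≤ e v := e.monotone v.2.1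
    rw [hv] at this
    exact this
  have h1 := abs_le.1 (abs_leftLim_sub_le hX hY he t)
  have h2 := abs_le.1 (abs_infOn_sub_le hX hY he (r := ⟨-1, by simp⟩)
    (t := ⟨t, Ioc_subset_Icc_self t.2⟩) t.2.1.le)
  rw [← coe_shift, hbot] at h2
  unfold height
  exact abs_le.2 ⟨by linarith, by linarith⟩

/-! ### Stability of the looptree distance near a pure jump path. -/

theorem PureJump.height_le (hPJ : PureJump X) (hX : IsPath X) {t : ℝ} (ht : t ∈ Ioc (-1 : ℝ) 1) :
    height X t ≤ jumpSum X t := by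
  rcases lt_or_ge t 0 with h0 | h0
  · have h1 : 0 ≤ jumpSum X t := tsum_nonneg fun r => R_nonneg X r t
    have h2 : 0 ≤ infOn X (-1) t :=
      le_infOn ht.1.le fun u hu => (hX.zero_before u ⟨hu.1, hu.2.trans_lt h0⟩).ge
    rw [height, hX.leftLim_of_nonpos ht.1 h0.le]
    linarith
  · have h1 := hPJ t ⟨h0, ht.2⟩
    rw [hX.contPart_eq ⟨h0, ht.2⟩] at h1
    linarith

/-- The left side is the height of `Y` minus its lengths in the image of `F`. By (PJ) the tail of
`X` is at least the height of `X` minus its lengths in `F`. The error is `2η` for the height and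
`2η` for each element of `F`. -/
theorem tailSum_shift_add_contPart_le (hX : IsPath X) (hPJ : PureJump X) (hY : IsPath Y)
    (he : ∀ t : Icc (-1 : ℝ) 1, |Y (e t) - X t| ≤ η) (F : Finset (Ioc (-1 : ℝ) 1))
    (t : Ioc (-1 : ℝ) 1) (ht : (shift e t : ℝ) ∈ Icc (0 : ℝ) 1) :
    tailSum Y (F.map (shift e)) (shift e t) + contPart Y (shift e t)
      ≤ tailSum X F t + 2 * (F.card + 1) * η := by
  have h1 := abs_le.1 (abs_height_sub_le hX hY he t)
  have h2 : ∑ r ∈ F, R X r t ≤ ∑ r ∈ F, (R Y (shift e r) (shift e t) + 2 * η) :=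
    Finset.sum_le_sum fun r _ => by linarith [(abs_le.1 (abs_R_sub_le hX hY he r t)).1]
  rw [Finset.sum_add_distrib, Finset.sum_const, nsmul_eq_mul] at h2
  have h3 := hPJ.height_le hX t.2
  rw [hY.contPart_eq ht, tailSum, tailSum, Finset.sum_map]
  linarith

theorem IsPath.loopSum_sub_sum_mem (h : IsPath X) {s t : ℝ} (hs : s ∈ Ioc (-1 : ℝ) 1)
    (ht : t ∈ Ioc (-1 : ℝ) 1) (F : Finset (Ioc (-1 : ℝ) 1)) :
    loopSum X s t - ∑ r ∈ F, cycleDist (jump X r) (R X r s) (R X r t)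
      ∈ Icc 0 (tailSum X F s + tailSum X F t) := by
  have h1 := tsum_sub_sum_le summable_zero (h.summable_cycleDist hs ht)
    (fun r => cycleDist_nonneg (h.R_mem r.2 hs.2) (h.R_mem r.2 ht.2)) F
  have h2 := tsum_sub_sum_le (h.summable_cycleDist hs ht)
    ((h.summable_R hs).add (h.summable_R ht)) (fun r => cycleDist_R_le X r s t) F
  rw [tsum_zero, Finset.sum_const_zero, sub_zero] at h1
  rw [(h.summable_R hs).tsum_add (h.summable_R ht), Finset.sum_add_distrib] at h2
  refine ⟨h1, ?_⟩
  unfold loopSum tailSum jumpSum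
  linarith

/-- Each cycle of `F` costs `6η`: `2η` for its length and for each of the two positions. The tails
and continuous parts of `Y` at both times add at most `2ε + 4(|F| + 1)η`, the tails of `X` at most
`2ε`. -/
theorem abs_distLoop_shift_sub_le (hX : IsPath X) (hPJ : PureJump X) (hY : IsPath Y)
    (he : ∀ t : Icc (-1 : ℝ) 1, |Y (e t) - X t| ≤ η) {F : Finset (Ioc (-1 : ℝ) 1)} {ε : ℝ}
    (hF : ∀ t ∈ Ioc (-1 : ℝ) 1, tailSum X F t ≤ ε) (s t : Ioc (-1 : ℝ) 1)
    (hs : (shift e s : ℝ) ∈ Icc (0 : ℝ) 1) (ht : (shift e t : ℝ) ∈ Icc (0 : ℝ) 1) :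
    |distLoop Y (shift e s) (shift e t) - loopSum X s t| ≤ 4 * ε + (10 * F.card + 4) * η := by
  have h1 := hX.loopSum_sub_sum_mem s.2 t.2 F
  have h2 := hY.loopSum_sub_sum_mem (shift e s).2 (shift e t).2 (F.map (shift e))
  have h3 := tailSum_shift_add_contPart_le hX hPJ hY he F s hs
  have h4 := tailSum_shift_add_contPart_le hX hPJ hY he F t ht
  have hC : ∀ x ∈ uIcc (shift e s : ℝ) (shift e t), 0 ≤ contPart Y x := fun x hx =>
    hY.contPart_nonneg (ordConnected_Icc.uIcc_subset hs ht hx)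
  have h5 := distTree_nonneg hC
  have h6 := distTree_le hC
  have h7 : |∑ r ∈ F, cycleDist (jump Y (shift e r)) (R Y (shift e r) (shift e s))
        (R Y (shift e r) (shift e t))
      - ∑ r ∈ F, cycleDist (jump X r) (R X r s) (R X r t)| ≤ F.card * (6 * η) := by
    rw [← Finset.sum_sub_distrib, ← nsmul_eq_mul]
    refine (Finset.abs_sum_le_sum_abs _ _).trans (Finset.sum_le_card_nsmul _ _ _ fun r _ => ?_)
    linarith [cycleDist_sub_le (jump Y (shift e r)) (jump X r) (R Y (shift e r) (shift e s))
      (R X r s) (R Y (shift e r) (shift e t)) (R X r t), abs_jump_sub_le hX hY he r,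
      abs_R_sub_le hX hY he r s, abs_R_sub_le hX hY he r t]
  rw [Finset.sum_map] at h2
  rw [hY.distLoop_eq hs ht]
  have h7 := abs_le.1 h7
  have h8 := hF s s.2
  have h9 := hF t t.2
  obtain ⟨h1a, h1b⟩ := h1
  obtain ⟨h2a, h2b⟩ := h2
  have h10 := hY.contPart_nonneg hs
  have h11 := hY.contPart_nonneg ht
  have h12 : 0 ≤ η := (abs_nonneg _).trans (he ⟨s, Ioc_subset_Icc_self s.2⟩)
  have h13 : 0 ≤ F.card * η := by positivity
  have h14 : 0 ≤ tailSum X F s + tailSum X F t := h1a.trans h1b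
  exact abs_le.2 ⟨by linarith, by linarith⟩

theorem IsPath.loopSum_max_zero (h : IsPath X) {s t : ℝ} (hs : s ≤ 1) (ht : t ≤ 1) :
    loopSum X (max s 0) (max t 0) = loopSum X s t :=
  tsum_congr fun r => by rw [h.R_max_zero r.2.1 hs, h.R_max_zero r.2.1 ht]

theorem PureJump.distLoop_eq (hPJ : PureJump X) (hX : IsPath X) {s t : ℝ}
    (hs : s ∈ Icc (0 : ℝ) 1) (ht : t ∈ Icc (0 : ℝ) 1) : distLoop X s t = loopSum X s t := by
  have hC : ∀ x ∈ uIcc s t, 0 ≤ contPart X x := fun x hx =>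
    hX.contPart_nonneg (ordConnected_Icc.uIcc_subset hs ht hx)
  have h1 := distTree_nonneg hC
  have h2 := distTree_le hC
  rw [hPJ s hs, hPJ t ht] at h2
  rw [hX.distLoop_eq hs ht]
  linarith

theorem exists_orderIso_of_skorokhodDist_lt (hη : skorokhodDist Y X < ENNReal.ofReal η) :
    ∃ e : Icc (-1 : ℝ) 1 ≃o Icc (-1 : ℝ) 1, (∀ t, |(e t : ℝ) - t| ≤ η) ∧
      ∀ t, |Y (e t) - X t| ≤ η := by
  have hη0 : 0 < η := ENNReal.ofReal_pos.1 (zero_le.trans_lt hη)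
  obtain ⟨e, he⟩ := iInf_lt_iff.1 hη
  obtain ⟨h1, h2⟩ := max_lt_iff.1 he
  refine ⟨e, fun t => ?_, fun t => ?_⟩
  · exact ((ENNReal.ofReal_le_ofReal_iff hη0.le).1 ((le_iSup (fun t : Icc (-1 : ℝ) 1 =>
      ENNReal.ofReal |(e t : ℝ) - t|) t).trans h1.le))
  · exact ((ENNReal.ofReal_le_ofReal_iff hη0.le).1 ((le_iSup (fun t : Icc (-1 : ℝ) 1 =>
      ENNReal.ofReal |Y (e t) - X t|) t).trans h2.le))

theorem exists_shift_eq (e : Icc (-1 : ℝ) 1 ≃o Icc (-1 : ℝ) 1) {s : ℝ}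
    (hs : s ∈ Icc (0 : ℝ) 1) : ∃ r : Ioc (-1 : ℝ) 1, (shift e r : ℝ) = s := by
  have hs' : s ∈ Icc (-1 : ℝ) 1 := Ioc_subset_Icc_self (mem_Ioc_of_mem_Icc hs)
  refine ⟨⟨e.symm ⟨s, hs'⟩, lt_of_le_of_lt (e.symm ⟨-1, by simp⟩).2.1
    (e.symm.strictMono (show (⟨-1, by simp⟩ : Icc (-1 : ℝ) 1) < ⟨s, hs'⟩ from
      (mem_Ioc_of_mem_Icc hs).1)), (e.symm _).2.2⟩, ?_⟩
  rw [coe_shift]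
  simp

theorem abs_sub_max_zero_le {s r : ℝ} (hs : 0 ≤ s) : |s - max r 0| ≤ |s - r| := by
  conv_lhs => rw [← max_eq_left hs]
  exact abs_max_sub_max_le_abs _ _ _

/-- Paths that are close to a pure jump path have close looptree distances. -/
theorem PureJump.exists_forall_abs_distLoop_sub_le (hPJ : PureJump X) (hX : IsPath X) {ε : ℝ}
    (hε : 0 < ε) : ∃ η > 0, ∀ Y : ℝ → ℝ, IsPath Y → skorokhodDist Y X < ENNReal.ofReal η →
      ∀ s ∈ Icc (0 : ℝ) 1, ∀ t ∈ Icc (0 : ℝ) 1, |distLoop Y s t - distLoop X s t| ≤ ε := by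
  obtain ⟨F, hF⟩ := hX.exists_tailSum_le (show 0 < ε / 16 by positivity)
  obtain ⟨δ, hδ, hδX⟩ := Metric.uniformContinuous_iff.1
    (CompactSpace.uniformContinuous_of_continuous hX.continuous_distUnit) (ε / 4) (by positivity)
  have hc : (0 : ℝ) < 10 * F.card + 4 := by positivity
  -- With tails at most `ε/16`, the comparison costs at most `ε/4 + ε/4`, and undoing the time
  -- change costs less than `ε/4`.
  refine ⟨min (δ / 2) (ε / 4 / (10 * F.card + 4)), by positivity, fun Y hY hYX s hs t ht => ?_⟩
  obtain ⟨e, he1, he2⟩ := exists_orderIso_of_skorokhodDist_lt hYX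
  generalize hη : min (δ / 2) (ε / 4 / (10 * F.card + 4)) = η at he1 he2
  have hη1 : η ≤ δ / 2 := hη ▸ min_le_left _ _
  have hη2 : (10 * F.card + 4) * η ≤ ε / 4 := by
    have : η ≤ ε / 4 / (10 * F.card + 4) := hη ▸ min_le_right _ _
    rwa [le_div_iff₀' hc] at this
  -- The preimage of a time in `[0,1]` may be negative. Replacing it by `0` changes no right-length
  -- and does not move it away from that time.
  have hclose : ∀ r : Ioc (-1 : ℝ) 1, ∀ u ∈ Icc (0 : ℝ) 1, (shift e r : ℝ) = u →
      max (r : ℝ) 0 ∈ Icc (0 : ℝ) 1 ∧ |u - max (r : ℝ) 0| < δ := by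
    rintro r _ hu rfl
    refine ⟨⟨le_max_right _ _, max_le r.2.2 zero_le_one⟩, ?_⟩
    refine ((abs_sub_max_zero_le hu.1).trans (he1 ⟨r, Ioc_subset_Icc_self r.2⟩)).trans_lt ?_
    linarith
  obtain ⟨a, ha⟩ := exists_shift_eq e hs
  obtain ⟨b, hb⟩ := exists_shift_eq e ht
  obtain ⟨ha0, hsa⟩ := hclose a s hs ha
  obtain ⟨hb0, htb⟩ := hclose b t ht hb
  have h1 := abs_distLoop_shift_sub_le hX hPJ hY he2 hF a b (ha ▸ hs) (hb ▸ ht)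
  rw [ha, hb, ← hX.loopSum_max_zero a.2.2 b.2.2, ← hPJ.distLoop_eq hX ha0 hb0] at h1
  have h2 := hδX (a := ((⟨s, hs⟩ : unitInterval), (⟨t, ht⟩ : unitInterval)))
    (b := ((⟨_, ha0⟩ : unitInterval), (⟨_, hb0⟩ : unitInterval))) (max_lt hsa htb)
  have h2 : |distLoop X s t - distLoop X (max (a : ℝ) 0) (max (b : ℝ) 0)| < ε / 4 := h2
  have h1 := abs_le.1 h1
  have h2 := abs_lt.1 h2
  exact abs_le.2 ⟨by linarith, by linarith⟩

end Comparison

end Looptree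

theorem mainTheorem10 (Xn : ℕ → ℝ → ℝ) (X : ℝ → ℝ)
    (hXn : ∀ n, Looptree.IsPath (Xn n)) (hX : Looptree.IsPath X)
    (hconv : Looptree.SkorokhodTendsto Xn X) (hPJ : Looptree.PureJump X) :
    -- the looptree distances are continuous pseudo-distances on `[0,1]`, so that the looptrees
    -- are compact metric spaces with Borel probability measures
    (∀ n, Looptree.IsPseudoDist (Looptree.distUnit (Xn n)) ∧
      Continuous (Function.uncurry (Looptree.distUnit (Xn n))) ∧
      CompactSpace (Looptree.Loop (Xn n)) ∧
      IsProbabilityMeasure (Looptree.loopMeasure (Xn n))) ∧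
    (Looptree.IsPseudoDist (Looptree.distUnit X) ∧
      Continuous (Function.uncurry (Looptree.distUnit X)) ∧
      CompactSpace (Looptree.Loop X) ∧
      IsProbabilityMeasure (Looptree.loopMeasure X)) ∧
    -- uniform convergence of the looptree distances on `[0,1] × [0,1]`
    TendstoUniformlyOn (fun n p => Looptree.distLoop (Xn n) p.1 p.2)
      (fun p : ℝ × ℝ => Looptree.distLoop X p.1 p.2) atTop (Icc 0 1 ×ˢ Icc 0 1) ∧
    -- convergence of the looptrees
    Tendsto (fun n => Looptree.ghpDist (Looptree.loopMeasure (Xn n)) (Looptree.loopMeasure X))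
      atTop (𝓝 0) := by
  have hunif : ∀ ε > 0, ∀ᶠ n in atTop, ∀ s ∈ Icc (0 : ℝ) 1, ∀ t ∈ Icc (0 : ℝ) 1,
      |Looptree.distLoop (Xn n) s t - Looptree.distLoop X s t| ≤ ε := fun ε hε => by
    obtain ⟨η, hη, h⟩ := hPJ.exists_forall_abs_distLoop_sub_le hX hε
    filter_upwards [(tendsto_order.1 hconv).2 _ (ENNReal.ofReal_pos.2 hη)] with n hn
    exact h _ (hXn n) hn
  refine ⟨fun n => ⟨(hXn n).isPseudoDist, (hXn n).continuous_distUnit, (hXn n).compactSpace,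
    (hXn n).isProbabilityMeasure⟩, ⟨hX.isPseudoDist, hX.continuous_distUnit, hX.compactSpace,
    hX.isProbabilityMeasure⟩, ?_, ?_⟩
  · refine Metric.tendstoUniformlyOn_iff.2 fun ε hε => ?_
    filter_upwards [hunif (ε / 2) (half_pos hε)] with n hn p hp
    rw [dist_comm, Real.dist_eq]
    linarith [hn p.1 hp.1 p.2 hp.2]
  · refine ENNReal.tendsto_nhds_zero.2 fun ε hε => ?_
    obtain ⟨ε', -, hε0, hε'⟩ := ENNReal.lt_iff_exists_real_btwn.1 hε
    have hε0 : 0 < ε' := ENNReal.ofReal_pos.1 hε0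
    -- Admissibility of `ε'` allows a distortion of `2 * ε'`.
    filter_upwards [hunif (2 * ε') (by positivity)] with n hn
    exact (Looptree.ghpDist_le (hXn n) hX hε0 hn).trans hε'.le
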